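/- All graphs are finite, simple and undirected. First-order sentences about graphs use the relation symbols for adjacency and equality of vertices; the variable width of a sentence is the number of distinct variables used to build it (a variable may be quantified repeatedly). For a graph $F$, let $W_{\mathrm{tw}}(F)$ denote the minimum variable width of a first-order sentence $\Phi$ for which there is a $k$ such that, for every connected graph $G$ of treewidth $\mathrm{tw}(G)\ge k$, $\Phi$ is true on $G$ if and only if $G$ contains a (not necessarily induced) subgraph isomorphic to $F$. Let the core $F_0$ of $F$ be the graph obtained from $F$ by removing, consecutively and as long as possible, vertices of degree at most $1$, and let $v(F_0)$ be its number of vertices. Let the megastar $M_{3,b}$ be the tree obtained by joining a central vertex to one end vertex of each of three disjoint paths with $b$ vertices. **Theorem 4.2.** 1. $W_{\mathrm{tw}}(F)\ge v(F_0)$ for every graph $F$. 2. $W_{\mathrm{tw}}(F)\ge \mathrm{tw}(F)+1$ for every connected graph $F$, except for the case that $F$ is (isomorphic to) a subtree of $M_{3,b}$ for some $b$. -/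

import Mathlib

open scoped SimpleGraph

/-! ### First-order logic of graphs, with named and reusable variables -/

/-- First-order formulas over adjacency and equality. The variables are `x₀, x₁, …`, named by
natural numbers, and the same variable may be quantified several times. -/
inductive GraphFormula : Type where
  | bot : GraphFormula
  | eq (i j : ℕ) : GraphFormula
  | adj (i j : ℕ) : GraphFormula
  | not (φ : GraphFormula) : GraphFormula
  | and (φ ψ : GraphFormula) : GraphFormula
  | or (φ ψ : GraphFormula) : GraphFormula
  | ex (i : ℕ) (φ : GraphFormula) : GraphFormula
  | all (i : ℕ) (φ : GraphFormula) : GraphFormula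

namespace GraphFormula

/-- All variables that are used to build the formula, free or bound. -/
def vars : GraphFormula → Finset ℕ
  | bot => ∅
  | eq i j => {i, j}
  | adj i j => {i, j}
  | not φ => φ.vars
  | and φ ψ => φ.vars ∪ ψ.vars
  | or φ ψ => φ.vars ∪ ψ.vars
  | ex i φ => insert i φ.vars
  | all i φ => insert i φ.vars

/-- The variables with a free occurrence. -/
def freeVars : GraphFormula → Finset ℕ
  | bot => ∅
  | eq i j => {i, j}
  | adj i j => {i, j}
  | not φ => φ.freeVars
  | and φ ψ => φ.freeVars ∪ ψ.freeVars
  | or φ ψ => φ.freeVars ∪ ψ.freeVars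
  | ex i φ => φ.freeVars.erase i
  | all i φ => φ.freeVars.erase i

/-- A sentence is a formula without free variables. -/
def IsSentence (φ : GraphFormula) : Prop := φ.freeVars = ∅

/-- The variable width: the number of distinct variables used. -/
def width (φ : GraphFormula) : ℕ := φ.vars.card

/-- Truth of a formula in the graph `G` under the assignment `s` of vertices to variables. -/
def Sat {V : Type*} (G : SimpleGraph V) : (ℕ → V) → GraphFormula → Prop
  | _, bot => False
  | s, eq i j => s i = s j
  | s, adj i j => G.Adj (s i) (s j)
  | s, not φ => ¬ Sat G s φ
  | s, and φ ψ => Sat G s φ ∧ Sat G s ψ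
  | s, or φ ψ => Sat G s φ ∨ Sat G s ψ
  | s, ex i φ => ∃ v : V, Sat G (Function.update s i v) φ
  | s, all i φ => ∀ v : V, Sat G (Function.update s i v) φ

/-- The truth value depends only on the values of the free variables. -/
theorem sat_congr {V : Type*} (G : SimpleGraph V) (φ : GraphFormula) :
    ∀ s t : ℕ → V, (∀ i ∈ φ.freeVars, s i = t i) → (Sat G s φ ↔ Sat G t φ) := by
  have key : ∀ (s t : ℕ → V) (S : Finset ℕ) (i : ℕ) (v : V),
      (∀ j ∈ S.erase i, s j = t j) →
      ∀ j ∈ S, Function.update s i v j = Function.update t i v j := by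
    intro s t S i v h j hj
    by_cases hji : j = i
    · subst hji; simp
    · simp [hji, h j (Finset.mem_erase.2 ⟨hji, hj⟩)]
  induction φ with
  | bot => intro s t _; exact Iff.rfl
  | eq i j => intro s t h; simp only [Sat, h i (by simp [freeVars]), h j (by simp [freeVars])]
  | adj i j => intro s t h; simp only [Sat, h i (by simp [freeVars]), h j (by simp [freeVars])]
  | not φ ih => intro s t h; exact not_congr (ih s t h)
  | and φ ψ ih1 ih2 =>
    intro s t h
    exact and_congr (ih1 s t fun i hi => h i (Finset.mem_union_left _ hi))
      (ih2 s t fun i hi => h i (Finset.mem_union_right _ hi))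
  | or φ ψ ih1 ih2 =>
    intro s t h
    exact or_congr (ih1 s t fun i hi => h i (Finset.mem_union_left _ hi))
      (ih2 s t fun i hi => h i (Finset.mem_union_right _ hi))
  | ex i φ ih => intro s t h; exact exists_congr fun v => ih _ _ (key s t _ i v h)
  | all i φ ih => intro s t h; exact forall_congr' fun v => ih _ _ (key s t _ i v h)

/-- `G ⊨ φ`, for a sentence `φ` and a graph `G` with at least one vertex; by `sat_congr` the
assignment plays no role. -/
def Models {V : Type*} (G : SimpleGraph V) (φ : GraphFormula) : Prop :=
  ∀ s : ℕ → V, Sat G s φ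

end GraphFormula

/-! ### Treewidth -/

/-- The sets `bag i`, indexed by the nodes of `T`, form a tree decomposition of `G`: `T` is a
tree, every vertex and every edge of `G` lies in some bag, and for every vertex the nodes whose
bags contain it induce a connected subgraph of `T`. -/
structure IsTreeDecomposition {V : Type*} (G : SimpleGraph V) {ι : Type} (T : SimpleGraph ι)
    (bag : ι → Set V) : Prop where
  isTree : T.IsTree
  vertex_mem : ∀ v : V, ∃ i, v ∈ bag i
  edge_mem : ∀ u v : V, G.Adj u v → ∃ i, u ∈ bag i ∧ v ∈ bag i
  connected : ∀ v : V, (T.induce {i | v ∈ bag i}).Connected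

/-- The treewidth of a finite nonempty graph: the least `w` such that there is a tree
decomposition (over a finite tree) all of whose bags have at most `w + 1` vertices. -/
noncomputable def treewidth {V : Type*} (G : SimpleGraph V) : ℕ :=
  sInf {w : ℕ | ∃ (ι : Type) (_ : Finite ι) (T : SimpleGraph ι) (bag : ι → Set V),
    IsTreeDecomposition G T bag ∧ ∀ i, (bag i).ncard ≤ w + 1}

/-! ### The core of a graph -/

/-- One deletion step: `S'` arises from the vertex set `S` by removing one vertex that has
degree at most 1 in the subgraph of `F` induced by `S`. -/
def PruneStep {V : Type*} (F : SimpleGraph V) (S S' : Set V) : Prop :=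
  ∃ v ∈ S, (F.neighborSet v ∩ S).ncard ≤ 1 ∧ S' = S \ {v}

/-- `C` is a possible outcome of removing, one after another and as long as possible, vertices
of degree at most 1 from `F`. -/
def IsCoreSet {V : Type*} (F : SimpleGraph V) (C : Set V) : Prop :=
  Relation.ReflTransGen (PruneStep F) Set.univ C ∧ ∀ S', ¬ PruneStep F C S'

/-- The outcome exists and does not depend on the order of the deletions. -/
theorem existsUnique_isCoreSet {V : Type*} [Finite V] (F : SimpleGraph V) :
    ∃! C : Set V, IsCoreSet F C := by
  have hex : ∀ (n : ℕ) (S : Set V), S.ncard = n →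
      ∃ C, Relation.ReflTransGen (PruneStep F) S C ∧ ∀ S', ¬ PruneStep F C S' := by
    intro n
    induction n with
    | zero =>
      intro S hS
      refine ⟨S, .refl, ?_⟩
      rintro S' ⟨v, hv, _⟩
      rw [Set.ncard_eq_zero] at hS
      simp [hS] at hv
    | succ n ih =>
      intro S hS
      by_cases h : ∃ S', PruneStep F S S'
      · obtain ⟨S', v, hv, hd, rfl⟩ := h
        obtain ⟨C, hC, hC'⟩ := ih (S \ {v}) (by rw [Set.ncard_sdiff_singleton_of_mem hv]; omega)
        exact ⟨C, .head ⟨v, hv, hd, rfl⟩ hC, hC'⟩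
      · exact ⟨S, .refl, fun S' hS' => h ⟨S', hS'⟩⟩
  have hsub : ∀ C D : Set V, (∀ S', ¬ PruneStep F C S') →
      Relation.ReflTransGen (PruneStep F) Set.univ D → C ⊆ D := by
    intro C D hC hD
    induction hD with
    | refl => exact Set.subset_univ C
    | tail _ hstep ih =>
      obtain ⟨v, hv, hd, rfl⟩ := hstep
      refine Set.subset_sdiff_singleton ih fun hvC => hC _ ⟨v, hvC, ?_, rfl⟩
      exact (Set.ncard_le_ncard (Set.inter_subset_inter_right _ ih)).trans hd
  obtain ⟨C, hC, hC'⟩ := hex _ Set.univ rfl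
  exact ⟨C, ⟨hC, hC'⟩, fun D hD =>
    Set.Subset.antisymm (hsub D C hD.2 hC) (hsub C D hC' hD.1)⟩

/-- The vertex set of the core `F₀` (the core itself is the subgraph of `F` induced by it). -/
noncomputable def coreSet {V : Type*} [Finite V] (F : SimpleGraph V) : Set V :=
  (existsUnique_isCoreSet F).choose

/-! ### Megastars -/

/-- The megastar `M_{s,t}`: `s` paths with `t` vertices each, and a centre `none` that is joined
to the first vertex of every path. -/
def megastar (s t : ℕ) : SimpleGraph (Option (Fin s × Fin t)) :=
  SimpleGraph.fromRel fun x y =>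
    match x, y with
    | none, some (_, j) => (j : ℕ) = 0
    | some (i, j), some (i', j') => i = i' ∧ (j' : ℕ) = (j : ℕ) + 1
    | _, _ => False

/-! ### Defining subgraph containment on connected graphs of large treewidth -/

/-- For some `k`, the sentence `φ` is true on a connected graph `G` of treewidth at least `k` if
and only if `G` contains a (not necessarily induced) subgraph isomorphic to `F`. -/
def DefinesSubgraphTw {V : Type*} (F : SimpleGraph V) (φ : GraphFormula) : Prop :=
  ∃ k : ℕ, ∀ (n : ℕ) (G : SimpleGraph (Fin n)), G.Connected → k ≤ treewidth G →
    (GraphFormula.Models G φ ↔ F ⊑ G)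

/-- Some sentence with at most `v(F)` variables defines containment of `F` on all nonempty graphs;
so the minimum `W_tw(F)` below is attained. -/
theorem exists_definesSubgraphTw {V : Type*} [Finite V] (F : SimpleGraph V) :
    ∃ φ : GraphFormula, φ.IsSentence ∧ DefinesSubgraphTw F φ ∧ φ.width ≤ Nat.card V := by
  classical
  have hsub : ∀ φ : GraphFormula, φ.freeVars ⊆ φ.vars := by
    intro φ
    induction φ with
    | bot => exact subset_rfl
    | eq i j => exact subset_rfl
    | adj i j => exact subset_rfl
    | not φ ih => exact ih
    | and φ ψ h1 h2 => exact Finset.union_subset_union h1 h2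
    | or φ ψ h1 h2 => exact Finset.union_subset_union h1 h2
    | ex i φ ih => exact (Finset.erase_subset _ _).trans (ih.trans (Finset.subset_insert _ _))
    | all i φ ih => exact (Finset.erase_subset _ _).trans (ih.trans (Finset.subset_insert _ _))
  have hand : ∀ (R : Finset ℕ) (l : List GraphFormula), (∀ ψ ∈ l, ψ.vars ⊆ R) →
      ∃ φ : GraphFormula, φ.vars ⊆ R ∧ ∀ (n : ℕ) (G : SimpleGraph (Fin n)) (s : ℕ → Fin n),
        GraphFormula.Sat G s φ ↔ ∀ ψ ∈ l, GraphFormula.Sat G s ψ := by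
    intro R l
    induction l with
    | nil => intro _; exact ⟨.not .bot, by simp [GraphFormula.vars], by simp [GraphFormula.Sat]⟩
    | cons a l ih =>
      intro h
      obtain ⟨φ, h1, h2⟩ := ih fun ψ hψ => h ψ (List.mem_cons_of_mem _ hψ)
      refine ⟨.and a φ, Finset.union_subset (h a List.mem_cons_self) h1, fun n G s => ?_⟩
      simp [GraphFormula.Sat, h2]
  have hexs : ∀ (R : Finset ℕ) (l : List ℕ) (φ : GraphFormula), φ.vars ⊆ R →
      (∀ i ∈ l, i ∈ R) → ∃ χ : GraphFormula, χ.vars ⊆ R ∧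
      (χ.freeVars ⊆ φ.freeVars.filter (· ∉ l)) ∧
      ∀ (n : ℕ) (G : SimpleGraph (Fin n)) (s : ℕ → Fin n), GraphFormula.Sat G s χ ↔
        ∃ t : ℕ → Fin n, (∀ i, i ∉ l → t i = s i) ∧ GraphFormula.Sat G t φ := by
    intro R l φ hφ
    induction l with
    | nil =>
      intro _
      refine ⟨φ, hφ, by simp, fun n G s => ⟨fun h => ⟨s, fun _ _ => rfl, h⟩, ?_⟩⟩
      rintro ⟨t, ht, h⟩
      rwa [show s = t from funext fun i => (ht i (by simp)).symm]
    | cons a l ih =>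
      intro hl
      obtain ⟨χ, h1, h2, h3⟩ := ih fun i hi => hl i (List.mem_cons_of_mem _ hi)
      refine ⟨.ex a χ, Finset.insert_subset (hl a List.mem_cons_self) h1, ?_, fun n G s => ?_⟩
      · intro i hi
        obtain ⟨hia, hi⟩ := Finset.mem_erase.1 hi
        have := Finset.mem_filter.1 (h2 hi)
        exact Finset.mem_filter.2 ⟨this.1, by simp [hia, this.2]⟩
      · simp only [GraphFormula.Sat, h3]
        constructor
        · rintro ⟨v, t, ht, h⟩
          refine ⟨t, fun i hi => ?_, h⟩
          rw [ht i (fun h' => hi (List.mem_cons_of_mem _ h')),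
            Function.update_of_ne (by rintro rfl; exact hi List.mem_cons_self)]
        · rintro ⟨t, ht, h⟩
          refine ⟨t a, t, fun i hi => ?_, h⟩
          by_cases hia : i = a
          · subst hia; simp
          · rw [Function.update_of_ne hia, ht i (by simp [hia, hi])]
  obtain ⟨m, ⟨e⟩⟩ := Finite.exists_equiv_fin V
  have hm : Nat.card V = m := by rw [Nat.card_congr e, Nat.card_fin]
  let f : V × V → GraphFormula := fun p =>
    if F.Adj p.1 p.2 then .adj (e p.1) (e p.2)
    else if p.1 = p.2 then .not .bot else .not (.eq (e p.1) (e p.2))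
  have := Fintype.ofFinite V
  obtain ⟨φ, hφ, hφs⟩ := hand (Finset.range m) ((Finset.univ : Finset (V × V)).toList.map f) (by
    intro ψ hψ
    obtain ⟨p, -, rfl⟩ := List.mem_map.1 hψ
    dsimp only [f]
    split_ifs <;> simp [GraphFormula.vars, Finset.insert_subset_iff])
  obtain ⟨χ, hχ, hχf, hχs⟩ := hexs (Finset.range m) (List.range m) φ hφ (by simp)
  refine ⟨χ, ?_, ⟨0, fun n G hG _ => ?_⟩, ?_⟩
  · refine Finset.eq_empty_of_forall_notMem fun i hi => ?_
    have h := Finset.mem_filter.1 (hχf hi)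
    have h' := hφ (hsub φ h.1)
    simp at h h'
    omega
  · have key : ∀ t : ℕ → Fin n, GraphFormula.Sat G t φ ↔
        (∀ u v, F.Adj u v → G.Adj (t (e u)) (t (e v))) ∧
          Function.Injective fun v => t (e v) := by
      intro t
      rw [hφs]
      constructor
      · intro h
        have h' : ∀ u v, GraphFormula.Sat G t (f (u, v)) := fun u v =>
          h _ (List.mem_map.2 ⟨(u, v), by simp, rfl⟩)
        have hadj : ∀ u v, F.Adj u v → G.Adj (t (e u)) (t (e v)) := by
          intro u v huv
          have := h' u v
          simpa [f, huv, GraphFormula.Sat] using this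
        refine ⟨hadj, fun u v huv => ?_⟩
        by_contra hne
        by_cases hA : F.Adj u v
        · exact (hadj u v hA).ne huv
        · have := h' u v
          simp only [f, hA, hne, if_false, GraphFormula.Sat] at this
          exact this huv
      · rintro ⟨h1, h2⟩ ψ hψ
        obtain ⟨⟨u, v⟩, -, rfl⟩ := List.mem_map.1 hψ
        dsimp only [f]
        split_ifs with hA hE
        · exact h1 u v hA
        · simp [GraphFormula.Sat]
        · exact fun h => hE (h2 h)
    constructor
    · intro h
      obtain ⟨t, -, ht⟩ := (hχs n G _).1 (h fun _ => hG.nonempty.some)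
      obtain ⟨h1, h2⟩ := (key t).1 ht
      exact ⟨⟨⟨fun v => t (e v), fun {a b} hab => h1 a b hab⟩, h2⟩⟩
    · rintro ⟨g⟩ s
      refine (hχs n G s).2 ⟨fun i => if hi : i < m then g (e.symm ⟨i, hi⟩) else s i, ?_, ?_⟩
      · intro i hi
        simp only [List.mem_range] at hi
        simp [hi]
      · rw [key]
        refine ⟨fun u v huv => ?_, fun u v huv => ?_⟩
        · simpa using g.toHom.map_adj huv
        · exact g.injective (by simpa using huv)
  · rw [hm]
    exact (Finset.card_le_card hχ).trans (by simp)

/-- `W_tw(F)`: the minimum variable width of a sentence that defines containment of `F` on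
connected graphs with sufficiently large treewidth. -/
noncomputable def Wtw {V : Type*} (F : SimpleGraph V) : ℕ :=
  sInf {w : ℕ | ∃ φ : GraphFormula, φ.IsSentence ∧ DefinesSubgraphTw F φ ∧ φ.width = w}

/-! Both bounds come from pairs of connected graphs of large treewidth that a sentence with few
variables cannot tell apart, although only one of them contains `F`.

For the core bound let `l` be the number of core vertices, and let `X` be a connected graph of large
minimum degree in which sets of at most `l` vertices induce forests. Hang a copy of `X` at every
vertex of the complete graph on `l`, respectively `l - 1`, vertices. Large minimum degree gives
large treewidth. In the first product the core is placed on the clique and the pruned vertices are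
added greedily. In the second some core vertex must leave the clique; the part of the core inside
its copy of `X` then has degree at least two except perhaps at the root, contradicting local
acyclicity. That is why the acyclicity statement yields a vertex of degree at most one different
from a prescribed vertex. With fewer than `l` variables a pebbling argument
(`sat_rootedProduct_iff`) shows that the two products satisfy the same sentences.

For the treewidth bound, pruned vertices cost only bags of size two. If the core is nonempty, one
bag for the whole core gives treewidth below `l`, and the first bound suffices. If the core is
empty, the treewidth is at most one, and a single variable has to be excluded: a one-variable
sentence has the same value on all nonempty graphs, whereas a large complete graph contains `F` and
a subdivided graph of maximum degree three and large treewidth (`starGrid`) does not. Its small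
connected subgraphs are subgraphs of megastars. -/

/-! ### Bounds on the treewidth -/

theorem exists_treeDecomposition_of_finite {V : Type*} [Finite V] (G : SimpleGraph V) :
    ∃ (ι : Type) (_ : Finite ι) (T : SimpleGraph ι) (bag : ι → Set V),
      IsTreeDecomposition G T bag ∧ ∀ i, (bag i).ncard ≤ Nat.card V + 1 := by
  refine ⟨Unit, inferInstance, ⊥, fun _ => Set.univ, ⟨.of_subsingleton, fun v => ⟨(), trivial⟩,
    fun u v _ => ⟨(), trivial, trivial⟩, fun v => ?_⟩, fun _ => ?_⟩
  · have : Nonempty {i : Unit | v ∈ (Set.univ : Set V)} := ⟨⟨(), trivial⟩⟩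
    exact (SimpleGraph.IsTree.of_subsingleton).connected
  · rw [Set.ncard_univ]; omega

/-- On finite graphs the treewidth is attained by some tree decomposition. -/
theorem exists_treeDecomposition_treewidth {V : Type*} [Finite V] (G : SimpleGraph V) :
    ∃ (ι : Type) (_ : Finite ι) (T : SimpleGraph ι) (bag : ι → Set V),
      IsTreeDecomposition G T bag ∧ ∀ i, (bag i).ncard ≤ treewidth G + 1 :=
  Nat.sInf_mem (s := {w : ℕ | ∃ (ι : Type) (_ : Finite ι) (T : SimpleGraph ι) (bag : ι → Set V),
    IsTreeDecomposition G T bag ∧ ∀ i, (bag i).ncard ≤ w + 1})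
    ⟨_, exists_treeDecomposition_of_finite G⟩

theorem SimpleGraph.Reachable.induce_mono {V : Type*} {G : SimpleGraph V} {s t : Set V} (h : s ⊆ t)
    {x y : V} (hx : x ∈ s) (hy : y ∈ s) (hxy : (G.induce s).Reachable ⟨x, hx⟩ ⟨y, hy⟩) :
    (G.induce t).Reachable ⟨x, h hx⟩ ⟨y, h hy⟩ :=
  hxy.map (SimpleGraph.induceHomOfLE G h).toHom

/-- Contracting connected sets does not increase the treewidth. -/
theorem treewidth_le_of_contraction {V W : Type*} [Finite V] {G : SimpleGraph V}
    {H : SimpleGraph W} (π : V → W) (hπ : Function.Surjective π)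
    (hfib : ∀ u v, π u = π v → Relation.ReflTransGen (fun a b => G.Adj a b ∧ π a = π b) u v)
    (hadj : ∀ a b, H.Adj a b → ∃ u v, G.Adj u v ∧ π u = a ∧ π v = b) :
    treewidth H ≤ treewidth G := by
  obtain ⟨ι, hι, T, bag, hT, hw⟩ := exists_treeDecomposition_treewidth G
  refine Nat.sInf_le ⟨ι, hι, T, fun i => π '' bag i, ⟨hT.isTree, fun a => ?_, fun a b hab => ?_,
    fun a => ?_⟩, fun i => (Set.ncard_image_le (Set.toFinite _)).trans (hw i)⟩
  · obtain ⟨v, rfl⟩ := hπ a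
    obtain ⟨i, hi⟩ := hT.vertex_mem v
    exact ⟨i, v, hi, rfl⟩
  · obtain ⟨u, v, huv, rfl, rfl⟩ := hadj a b hab
    obtain ⟨i, hu, hv⟩ := hT.edge_mem u v huv
    exact ⟨i, ⟨u, hu, rfl⟩, v, hv, rfl⟩
  · have hsub : ∀ v, π v = a → {i | v ∈ bag i} ⊆ {i | a ∈ π '' bag i} :=
      fun v hv i hi => ⟨v, hi, hv⟩
    -- Along a walk inside the fibre, the subtrees of consecutive vertices meet at a node whose bag
    -- contains the edge between them.
    have key : ∀ u v, Relation.ReflTransGen (fun a b => G.Adj a b ∧ π a = π b) u v →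
        ∀ (hu : π u = a) (hv : π v = a) i j (hi : u ∈ bag i) (hj : v ∈ bag j),
        (T.induce {i | a ∈ π '' bag i}).Reachable ⟨i, u, hi, hu⟩ ⟨j, v, hj, hv⟩ := by
      intro u v huv hu
      induction huv with
      | refl =>
        intro hv i j hi hj
        exact ((hT.connected u).preconnected ⟨i, hi⟩ ⟨j, hj⟩).induce_mono (hsub u hu)
      | tail _ hbc ih =>
        rename_i b c _
        intro hc i j hi hj
        obtain ⟨m, hbm, hcm⟩ := hT.edge_mem b c hbc.1
        exact (ih (hbc.2.trans hc) i m hi hbm).trans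
          (((hT.connected c).preconnected ⟨m, hcm⟩ ⟨j, hj⟩).induce_mono (hsub c hc))
    obtain ⟨v, rfl⟩ := hπ a
    obtain ⟨i, hi⟩ := hT.vertex_mem v
    have : Nonempty {i | π v ∈ π '' bag i} := ⟨⟨i, v, hi, rfl⟩⟩
    refine ⟨?_⟩
    rintro ⟨i, u, hui, hu⟩ ⟨j, u', huj, hu'⟩
    exact key u u' (hfib u u' (hu.trans hu'.symm)) hu hu' i j hui huj

theorem SimpleGraph.Iso.treewidth_eq {V W : Type*} [Finite V] {G : SimpleGraph V}
    {H : SimpleGraph W} (e : G ≃g H) : treewidth G = treewidth H := by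
  have key : ∀ {V W : Type _} [Finite V] {G : SimpleGraph V} {H : SimpleGraph W},
      G ≃g H → treewidth H ≤ treewidth G := by
    intro V W _ G H e
    refine treewidth_le_of_contraction e e.surjective (fun u v h => ?_) fun a b h =>
      ⟨e.symm a, e.symm b, e.symm.map_adj_iff.2 h, by simp, by simp⟩
    rw [e.injective h]
  have : Finite W := .of_equiv V e.toEquiv
  refine le_antisymm ?_ (key e)
  refine treewidth_le_of_contraction e.symm e.symm.surjective (fun u v h => ?_) fun a b h =>
      ⟨e a, e b, e.map_adj_iff.2 h, by simp, by simp⟩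
  rw [e.symm.injective h]

/-- In a tree, the node of a subtree closest to the root separates the subtree from the root:
two intersecting subtrees whose top nodes are `t` and `t'` share the lower one of them. -/
theorem SimpleGraph.IsTree.mem_of_top {ι : Type*} {T : SimpleGraph ι} (hT : T.IsTree) (r : ι)
    {A B : Set ι} (hA : (T.induce A).Connected) (hB : (T.induce B).Connected) {i t t' : ι}
    (hiA : i ∈ A) (hiB : i ∈ B) (htA : t ∈ A) (ht'B : t' ∈ B)
    (htop : ∀ j ∈ A, T.dist t r ≤ T.dist j r) (htop' : ∀ j ∈ B, T.dist t' r ≤ T.dist j r)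
    (hle : T.dist t' r ≤ T.dist t r) : t ∈ B := by
  classical
  have key : ∀ (A : Set ι), (T.induce A).Connected → ∀ t (_ : i ∈ A) (_ : t ∈ A),
      (∀ j ∈ A, T.dist t r ≤ T.dist j r) →
      ∃ (p : T.Walk i t) (q : T.Walk t r), (p.append q).IsPath ∧ q.length = T.dist t r ∧
        ∀ x ∈ p.support, x ∈ A := by
    intro A hA t hi ht htop
    obtain ⟨w, hw⟩ := (hA.preconnected ⟨i, hi⟩ ⟨t, ht⟩).exists_isPath
    obtain ⟨q, hq, hql⟩ := (hT.connected t r).exists_path_of_dist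
    obtain ⟨p, hp, hpA⟩ : ∃ p : T.Walk i t, p.IsPath ∧ ∀ x ∈ p.support, x ∈ A := by
      refine ⟨w.map (SimpleGraph.Embedding.induce A).toHom,
        (SimpleGraph.Walk.isPath_map_iff_of_injective Subtype.val_injective).2 hw, fun x hx => ?_⟩
      obtain ⟨y, -, rfl⟩ := List.mem_map.1 ((SimpleGraph.Walk.support_map _ w) ▸ hx)
      exact y.2
    refine ⟨p, q, ?_, hql, hpA⟩
    rw [SimpleGraph.Walk.isPath_def, SimpleGraph.Walk.support_append, List.nodup_append']
    refine ⟨hp.support_nodup, hq.support_nodup.tail, fun x hx hx' => ?_⟩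
    have h1 := htop x (hpA x hx)
    rw [← hql] at h1
    cases q with
    | nil => simp at hx'
    | cons h q =>
      have h2 := SimpleGraph.dist_le (q.dropUntil x (by simpa using hx'))
      have h3 := q.length_dropUntil_le_length (by simpa using hx' : x ∈ q.support)
      simp only [SimpleGraph.Walk.length_cons] at h1
      omega
  -- Both composites are the unique path from `i` to the root. As `t` is no nearer to the root than
  -- `t'`, it occurs on the initial segment from `i` to `t'`, which stays in `B`.
  obtain ⟨p, q, hpq, hq, hp⟩ := key A hA t hiA htA htop
  obtain ⟨p', q', hpq', hq', hp'⟩ := key B hB t' hiB ht'B htop'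
  have heq := (hT.existsUnique_path i r).unique hpq hpq'
  have hlen := congrArg SimpleGraph.Walk.length heq
  simp only [SimpleGraph.Walk.length_append] at hlen
  have h1 : (p.append q).getVert p.length = t := by
    simp [SimpleGraph.Walk.getVert_append]
  have h2 : (p'.append q').getVert p.length = p'.getVert p.length := by
    rw [SimpleGraph.Walk.getVert_append']
    rw [if_pos (by omega)]
  rw [heq, h2] at h1
  rw [← h1]
  exact hp' _ (SimpleGraph.Walk.getVert_mem_support _ _)

/-- The treewidth is at least the minimum degree. -/
theorem exists_ncard_neighborSet_le_treewidth {V : Type*} [Finite V] [Nonempty V]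
    (G : SimpleGraph V) : ∃ v, (G.neighborSet v).ncard ≤ treewidth G := by
  obtain ⟨ι, hι, T, bag, hT, hw⟩ := exists_treeDecomposition_treewidth G
  have r : ι := hT.isTree.connected.nonempty.some
  have htop : ∀ v, ∃ t, v ∈ bag t ∧ ∀ j, v ∈ bag j → T.dist t r ≤ T.dist j r := fun v =>
    Set.exists_min_image {i | v ∈ bag i} (fun i => T.dist i r) (Set.toFinite _) (hT.vertex_mem v)
  choose t ht htop using htop
  -- For the vertex with the deepest top node, every neighbour lies in that top bag.
  obtain ⟨v, hv⟩ := Finite.exists_max fun v => T.dist (t v) r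
  refine ⟨v, ?_⟩
  have hsub : G.neighborSet v ⊆ bag (t v) \ {v} := by
    intro u huv
    obtain ⟨i, hvi, hui⟩ := hT.edge_mem v u huv
    exact ⟨hT.isTree.mem_of_top r (hT.connected v) (hT.connected u) hvi hui (ht v) (ht u)
      (htop v) (htop u) (hv u), fun h => G.ne_of_adj huv h.symm⟩
  refine (Set.ncard_le_ncard hsub).trans ?_
  rw [Set.ncard_sdiff_singleton_of_mem (ht v)]
  have := hw (t v)
  omega

/-- Attaching a new leaf to a tree yields a tree. -/
theorem SimpleGraph.IsTree.addLeaf {ι : Type*} [Finite ι] {T : SimpleGraph ι} (hT : T.IsTree)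
    (i : ι) : (T.map (Function.Embedding.some) ⊔ SimpleGraph.edge none (some i)).IsTree := by
  rw [SimpleGraph.isTree_iff_connected_and_card] at hT ⊢
  obtain ⟨hc, hcard⟩ := hT
  have hmap : T.map Function.Embedding.some ≤
    T.map Function.Embedding.some ⊔ SimpleGraph.edge none (some i) := le_sup_left
  have hsome : ∀ j j', (T.map Function.Embedding.some ⊔ SimpleGraph.edge none (some i)).Reachable
      (some j) (some j') := fun j j' =>
    ((hc j j').map (SimpleGraph.Embedding.map Function.Embedding.some T).toHom).mono hmap
  have hnone : ∀ x, (T.map Function.Embedding.some ⊔ SimpleGraph.edge none (some i)).Reachable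
      (some i) x := by
    rintro (_ | j)
    · refine SimpleGraph.Adj.reachable (Or.inr ?_)
      simp [SimpleGraph.edge_adj]
    · exact hsome _ _
  refine ⟨⟨fun x y => (hnone x).symm.trans (hnone y)⟩, ?_⟩
  rw [SimpleGraph.edgeSet_sup, SimpleGraph.edgeSet_map, SimpleGraph.edgeSet_edge_of_ne (by simp),
    Set.union_singleton, Finite.card_option, ← hcard, Nat.card_coe_set_eq, Set.ncard_insert_of_notMem,
    Set.ncard_image_of_injective _ (Function.Embedding.injective _), Nat.card_coe_set_eq]
  rintro ⟨e, -, he⟩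
  induction e with
  | h a b => simp at he

/-- If the pruning process leads from `univ` to `C`, then a tree decomposition of the subgraph
induced by `C` can be extended by bags of size two. -/
theorem treewidth_le_of_pruneStep {V : Type*} [Finite V] {F : SimpleGraph V} {C : Set V}
    (hC : Relation.ReflTransGen (PruneStep F) Set.univ C) {w : ℕ} (hw : 1 ≤ w)
    (hCw : C.ncard ≤ w + 1) : treewidth F ≤ w := by
  suffices h : ∃ (ι : Type) (_ : Finite ι) (T : SimpleGraph ι) (bag : ι → Set V), T.IsTree ∧
      (∀ i, bag i ⊆ Set.univ) ∧ (∀ v ∈ Set.univ, ∃ i, v ∈ bag i) ∧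
      (∀ u ∈ Set.univ, ∀ v ∈ Set.univ, F.Adj u v → ∃ i, u ∈ bag i ∧ v ∈ bag i) ∧
      (∀ v ∈ Set.univ, (T.induce {i | v ∈ bag i}).Connected) ∧ ∀ i, (bag i).ncard ≤ w + 1 by
    obtain ⟨ι, hι, T, bag, hT, -, hv, he, hc, hb⟩ := h
    exact Nat.sInf_le ⟨ι, hι, T, bag, ⟨hT, fun v => hv v trivial,
      fun u v => he u trivial v trivial, fun v => hc v trivial⟩, hb⟩
  generalize Set.univ = S at hC ⊢
  induction hC using Relation.ReflTransGen.head_induction_on with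
  | refl =>
    refine ⟨Unit, inferInstance, ⊥, fun _ => C, .of_subsingleton, fun _ => subset_rfl,
      fun v hv => ⟨(), hv⟩, fun u hu v hv _ => ⟨(), hu, hv⟩, fun v hv => ?_, fun _ => hCw⟩
    have : Nonempty {i : Unit | v ∈ C} := ⟨⟨(), hv⟩⟩
    exact (SimpleGraph.IsTree.of_subsingleton).connected
  | head hstep _ ih =>
    obtain ⟨v, hvS, hdeg, rfl⟩ := hstep
    rename_i S _
    obtain ⟨ι, hι, T, bag, hT, hsub, hv, he, hc, hb⟩ := ih
    -- The new bag holds `v` and its only surviving neighbour, if any, and is attached at a node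
    -- whose bag contains that neighbour.
    obtain ⟨i₀, B, hB, hBS, hBcard, hBv, hN⟩ : ∃ (i₀ : ι) (B : Set V), B ⊆ insert v (bag i₀) ∧
        B ⊆ S ∧ B.ncard ≤ 2 ∧ v ∈ B ∧ ∀ u ∈ S, F.Adj v u → u ∈ B := by
      rcases Set.eq_empty_or_nonempty (F.neighborSet v ∩ S) with h | ⟨u, hu⟩
      · exact ⟨hT.connected.nonempty.some, {v}, by simp, by simpa, by simp, rfl,
          fun u hu huv => absurd (show u ∈ F.neighborSet v ∩ S from ⟨huv, hu⟩) (by simp [h])⟩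
      · obtain ⟨i, hi⟩ := hv u ⟨hu.2, (F.ne_of_adj hu.1).symm⟩
        refine ⟨i, {v, u}, ?_, ?_, (Set.ncard_insert_le v {u}).trans (by simp), by simp, fun x hx hvx => ?_⟩
        · rintro x (rfl | rfl) <;> simp [hi]
        · rintro x (rfl | rfl)
          exacts [hvS, hu.2]
        · exact Or.inr ((Set.ncard_le_one (Set.toFinite _)).1 hdeg x ⟨hvx, hx⟩ u hu)
    refine ⟨Option ι, inferInstance, _, fun x => x.elim B bag, hT.addLeaf i₀, ?_, ?_, ?_, ?_, ?_⟩
    · rintro (_ | i)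
      exacts [hBS, (hsub i).trans Set.sdiff_subset]
    · intro u hu
      by_cases huv : u = v
      · exact ⟨none, huv ▸ hBv⟩
      · obtain ⟨i, hi⟩ := hv u ⟨hu, huv⟩
        exact ⟨some i, hi⟩
    · intro a ha b hb hab
      by_cases hav : a = v
      · subst hav
        exact ⟨none, hBv, hN b hb hab⟩
      by_cases hbv : b = v
      · subst hbv
        exact ⟨none, hN a ha hab.symm, hBv⟩
      obtain ⟨i, hi⟩ := he a ⟨ha, hav⟩ b ⟨hb, hbv⟩ hab
      exact ⟨some i, hi⟩
    · intro u hu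
      by_cases huv : u = v
      · subst huv
        have hsing : {x : Option ι | u ∈ x.elim B bag} = {none} := by
          ext (_ | i)
          · simpa using hBv
          · simpa using fun h => (hsub i h).2 rfl
        rw [hsing]
        have : Nonempty ({none} : Set (Option ι)) := ⟨⟨none, rfl⟩⟩
        exact (SimpleGraph.IsTree.of_subsingleton).connected
      · have hcu := hc u ⟨hu, huv⟩
        have hsome : ∀ (i j : ι) (hi : u ∈ bag i) (hj : u ∈ bag j),
            ((T.map (Function.Embedding.some) ⊔ SimpleGraph.edge none (some i₀)).induce
              {x : Option ι | u ∈ x.elim B bag}).Reachable ⟨some i, hi⟩ ⟨some j, hj⟩ := by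
          intro i j hi hj
          refine (hcu.preconnected ⟨i, hi⟩ ⟨j, hj⟩).map
            (G' := (T.map (Function.Embedding.some) ⊔ SimpleGraph.edge none (some i₀)).induce
              {x : Option ι | u ∈ x.elim B bag}) ⟨fun x => ⟨some x.1, x.2⟩, fun {a b} hab => ?_⟩
          exact Or.inl ((SimpleGraph.map_adj_apply (f := Function.Embedding.some)).2 hab)
        obtain ⟨i, hi⟩ := hv u ⟨hu, huv⟩
        have hall : ∀ x : {x : Option ι | u ∈ x.elim B bag},
            ((T.map (Function.Embedding.some) ⊔ SimpleGraph.edge none (some i₀)).induce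
              {x : Option ι | u ∈ x.elim B bag}).Reachable ⟨some i, hi⟩ x := by
          rintro ⟨_ | j, hj⟩
          · have hi₀ : u ∈ bag i₀ := (hB hj).resolve_left huv
            refine (hsome i i₀ hi hi₀).trans (SimpleGraph.Adj.reachable (Or.inr ?_))
            simp [SimpleGraph.edge_adj]
          · exact hsome i j hi hj
        have : Nonempty {x : Option ι | u ∈ x.elim B bag} := ⟨⟨some i, hi⟩⟩
        exact ⟨fun x y => (hall x).symm.trans (hall y)⟩
    · rintro (_ | i)
      · exact hBcard.trans (by omega)
      · exact hb i

/-! ### Isomorphism invariance and one-variable formulas -/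

namespace GraphFormula

theorem freeVars_subset_vars (φ : GraphFormula) : φ.freeVars ⊆ φ.vars := by
  induction φ with
  | bot => exact subset_rfl
  | eq i j => exact subset_rfl
  | adj i j => exact subset_rfl
  | not φ ih => exact ih
  | and φ ψ h1 h2 => exact Finset.union_subset_union h1 h2
  | or φ ψ h1 h2 => exact Finset.union_subset_union h1 h2
  | ex i φ ih => exact (Finset.erase_subset _ _).trans (ih.trans (Finset.subset_insert _ _))
  | all i φ ih => exact (Finset.erase_subset _ _).trans (ih.trans (Finset.subset_insert _ _))

theorem sat_iso {V W : Type*} {G : SimpleGraph V} {H : SimpleGraph W} (e : G ≃g H)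
    (φ : GraphFormula) : ∀ s : ℕ → V, Sat G s φ ↔ Sat H (fun i => e (s i)) φ := by
  have key : ∀ (s : ℕ → V) (i : ℕ) (v : V), (fun j => e (Function.update s i v j)) =
      Function.update (fun j => e (s j)) i (e v) := fun s i v => by
    ext j
    by_cases h : j = i
    · subst h; simp
    · simp [h]
  induction φ with
  | bot => intro s; exact Iff.rfl
  | eq i j => intro s; simp [Sat]
  | adj i j => intro s; exact e.map_adj_iff.symm
  | not φ ih => intro s; exact not_congr (ih s)
  | and φ ψ h1 h2 => intro s; exact and_congr (h1 s) (h2 s)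
  | or φ ψ h1 h2 => intro s; exact or_congr (h1 s) (h2 s)
  | ex i φ ih =>
    intro s
    simp only [Sat, ih, key]
    exact ⟨fun ⟨v, hv⟩ => ⟨e v, hv⟩, fun ⟨v, hv⟩ => ⟨e.symm v, by simpa using hv⟩⟩
  | all i φ ih =>
    intro s
    simp only [Sat, ih, key]
    exact ⟨fun h v => by simpa using h (e.symm v), fun h v => h (e v)⟩

theorem models_iso {V W : Type*} {G : SimpleGraph V} {H : SimpleGraph W} (e : G ≃g H)
    (φ : GraphFormula) : Models G φ ↔ Models H φ := by
  refine ⟨fun h s => ?_, fun h s => (sat_iso e φ s).2 (h _)⟩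
  simpa using (sat_iso e φ fun i => e.symm (s i)).1 (h _)

/-- A formula with a single variable has the same truth value in all graphs. -/
theorem sat_iff_of_vars_subset_singleton {V W : Type*} [Nonempty V] [Nonempty W]
    (G : SimpleGraph V) (H : SimpleGraph W) (i₀ : ℕ) (φ : GraphFormula) (hφ : φ.vars ⊆ {i₀}) :
    ∀ (s : ℕ → V) (t : ℕ → W), Sat G s φ ↔ Sat H t φ := by
  induction φ with
  | bot => intro s t; exact Iff.rfl
  | eq i j =>
    intro s t
    have hi := Finset.mem_singleton.1 (hφ (show i ∈ ({i, j} : Finset ℕ) by simp))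
    have hj := Finset.mem_singleton.1 (hφ (show j ∈ ({i, j} : Finset ℕ) by simp))
    subst hi; subst hj
    simp [Sat]
  | adj i j =>
    intro s t
    have hi := Finset.mem_singleton.1 (hφ (show i ∈ ({i, j} : Finset ℕ) by simp))
    have hj := Finset.mem_singleton.1 (hφ (show j ∈ ({i, j} : Finset ℕ) by simp))
    subst hi; subst hj
    simp [Sat]
  | not φ ih => intro s t; exact not_congr (ih hφ s t)
  | and φ ψ h1 h2 =>
    intro s t
    exact and_congr (h1 (Finset.union_subset_left hφ) s t) (h2 (Finset.union_subset_right hφ) s t)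
  | or φ ψ h1 h2 =>
    intro s t
    exact or_congr (h1 (Finset.union_subset_left hφ) s t) (h2 (Finset.union_subset_right hφ) s t)
  | ex i φ ih =>
    intro s t
    have ih := ih ((Finset.subset_insert _ _).trans hφ)
    exact ⟨fun ⟨_, h⟩ => ⟨Classical.arbitrary W, (ih _ _).1 h⟩,
      fun ⟨_, h⟩ => ⟨Classical.arbitrary V, (ih _ _).2 h⟩⟩
  | all i φ ih =>
    intro s t
    have ih := ih ((Finset.subset_insert _ _).trans hφ)
    exact ⟨fun h _ => (ih _ _).1 (h (Classical.arbitrary V)),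
      fun h _ => (ih _ _).2 (h (Classical.arbitrary W))⟩

end GraphFormula

/-! ### Rooted products and the pebbling argument -/

/-- The complete graph on `A` with a copy of the rooted graph `(X, r)` hung at each vertex. -/
def rootedProduct (A : Type*) {X : Type*} (G : SimpleGraph X) (r : X) : SimpleGraph (A × X) where
  Adj p q := (p.1 = q.1 ∧ G.Adj p.2 q.2) ∨ (p.1 ≠ q.1 ∧ p.2 = r ∧ q.2 = r)
  symm := ⟨fun _ _ h => h.imp (fun h => ⟨h.1.symm, h.2.symm⟩) fun h => ⟨h.1.symm, h.2.2, h.2.1⟩⟩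
  loopless := ⟨fun _ h => h.elim (fun h => G.irrefl h.2) fun h => h.1 rfl⟩

/-- With fewer variables than copies, the number of copies in a rooted product with a complete
graph cannot be counted. -/
theorem sat_rootedProduct_iff {A B : Type} {X : Type*} [Finite A] [Finite B] (G : SimpleGraph X) (r : X)
    (U : Finset ℕ) (hA : U.card ≤ Nat.card A) (hB : U.card ≤ Nat.card B) (φ : GraphFormula)
    (hφ : φ.vars ⊆ U) (s : ℕ → A × X) (t : ℕ → B × X)
    (hst : ∀ i ∈ φ.freeVars, (s i).2 = (t i).2)
    (hst' : ∀ i ∈ φ.freeVars, ∀ j ∈ φ.freeVars, (s i).1 = (s j).1 ↔ (t i).1 = (t j).1) :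
    φ.Sat (rootedProduct A G r) s ↔ φ.Sat (rootedProduct B G r) t := by
  -- The invariant is that corresponding variables have equal `X`-coordinates and the same pattern
  -- of coincidences between copies. When `i` is reassigned, the answer is the copy matching an
  -- already occupied one, or else an unoccupied copy, which exists because the other variables
  -- number fewer than `U.card`.
  have pick : ∀ {A B : Type} [Finite B] (s : ℕ → A × X) (t : ℕ → B × X) (D : Finset ℕ) (i : ℕ)
      (a : A), i ∈ U → D ⊆ U → U.card ≤ Nat.card B →
      (∀ j ∈ D.erase i, ∀ l ∈ D.erase i, (s j).1 = (s l).1 ↔ (t j).1 = (t l).1) →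
      ∃ b : B, ∀ j ∈ D.erase i, a = (s j).1 ↔ b = (t j).1 := by
    intro A B _ s t D i a hi hD hB h
    classical
    by_cases hex : ∃ j ∈ D.erase i, a = (s j).1
    · obtain ⟨j, hj, rfl⟩ := hex
      exact ⟨(t j).1, fun l hl => h j hj l hl⟩
    · have := Fintype.ofFinite B
      have hcard : ((D.erase i).image fun j => (t j).1).card < Fintype.card B := by
        refine Finset.card_image_le.trans_lt (lt_of_lt_of_le ?_ (hB.trans_eq Nat.card_eq_fintype_card))
        exact (Finset.card_le_card (Finset.erase_subset_erase i hD)).trans_lt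
          (Finset.card_erase_lt_of_mem hi)
      obtain ⟨b, hb⟩ := Finset.exists_mem_notMem_of_card_lt_card
        (s := (D.erase i).image fun j => (t j).1) (t := Finset.univ) (by rwa [Finset.card_univ])
      refine ⟨b, fun j hj => iff_of_false (fun h => hex ⟨j, hj, h⟩) fun h => hb.2 ?_⟩
      exact Finset.mem_image.2 ⟨j, hj, h.symm⟩
  have upd : ∀ {A B : Type} (s : ℕ → A × X) (t : ℕ → B × X) (D : Finset ℕ) (i : ℕ)
      (a : A) (b : B) (x : X), (∀ j ∈ D.erase i, (s j).2 = (t j).2) →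
      (∀ j ∈ D.erase i, ∀ l ∈ D.erase i, (s j).1 = (s l).1 ↔ (t j).1 = (t l).1) →
      (∀ j ∈ D.erase i, a = (s j).1 ↔ b = (t j).1) →
      (∀ j ∈ D, (Function.update s i (a, x) j).2 = (Function.update t i (b, x) j).2) ∧
      (∀ j ∈ D, ∀ l ∈ D, (Function.update s i (a, x) j).1 = (Function.update s i (a, x) l).1 ↔
        (Function.update t i (b, x) j).1 = (Function.update t i (b, x) l).1) := by
    intro A B s t D i a b x h1 h2 h3
    refine ⟨fun j hj => ?_, fun j hj l hl => ?_⟩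
    · by_cases hji : j = i
      · subst hji; simp
      · simpa [hji] using h1 j (Finset.mem_erase.2 ⟨hji, hj⟩)
    · by_cases hji : j = i <;> by_cases hli : l = i
      · subst hji; subst hli; simp
      · subst hji
        simpa [hli] using h3 l (Finset.mem_erase.2 ⟨hli, hl⟩)
      · subst hli
        simpa [hji, eq_comm] using h3 j (Finset.mem_erase.2 ⟨hji, hj⟩)
      · simpa [hji, hli] using h2 j (Finset.mem_erase.2 ⟨hji, hj⟩) l (Finset.mem_erase.2 ⟨hli, hl⟩)
  induction φ generalizing s t with
  | bot => exact Iff.rfl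
  | eq i j =>
    have hi := hst i (by simp [GraphFormula.freeVars])
    have hj := hst j (by simp [GraphFormula.freeVars])
    have hij := hst' i (by simp [GraphFormula.freeVars]) j (by simp [GraphFormula.freeVars])
    simp only [GraphFormula.Sat, Prod.ext_iff, hi, hj, hij]
  | adj i j =>
    have hi := hst i (by simp [GraphFormula.freeVars])
    have hj := hst j (by simp [GraphFormula.freeVars])
    have hij := hst' i (by simp [GraphFormula.freeVars]) j (by simp [GraphFormula.freeVars])
    simp only [GraphFormula.Sat, rootedProduct, hi, hj, hij, ne_eq]
  | not φ ih => exact not_congr (ih hφ s t hst hst')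
  | and φ ψ h1 h2 =>
    have hl : φ.freeVars ⊆ (φ.and ψ).freeVars := Finset.subset_union_left
    have hr : ψ.freeVars ⊆ (φ.and ψ).freeVars := Finset.subset_union_right
    exact and_congr
      (h1 (Finset.union_subset_left hφ) s t (fun i hi => hst i (hl hi))
        fun i hi j hj => hst' i (hl hi) j (hl hj))
      (h2 (Finset.union_subset_right hφ) s t (fun i hi => hst i (hr hi))
        fun i hi j hj => hst' i (hr hi) j (hr hj))
  | or φ ψ h1 h2 =>
    have hl : φ.freeVars ⊆ (φ.or ψ).freeVars := Finset.subset_union_left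
    have hr : ψ.freeVars ⊆ (φ.or ψ).freeVars := Finset.subset_union_right
    exact or_congr
      (h1 (Finset.union_subset_left hφ) s t (fun i hi => hst i (hl hi))
        fun i hi j hj => hst' i (hl hi) j (hl hj))
      (h2 (Finset.union_subset_right hφ) s t (fun i hi => hst i (hr hi))
        fun i hi j hj => hst' i (hr hi) j (hr hj))
  | ex i φ ih =>
    have hi : i ∈ U := hφ (Finset.mem_insert_self _ _)
    have hU : φ.vars ⊆ U := (Finset.subset_insert _ _).trans hφ
    have hD := φ.freeVars_subset_vars.trans hU
    constructor
    · rintro ⟨⟨a, x⟩, h⟩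
      obtain ⟨b, hb⟩ := pick s t _ i a hi hD hB hst'
      obtain ⟨h1, h2⟩ := upd s t _ i a b x hst hst' hb
      exact ⟨(b, x), (ih hU _ _ h1 h2).1 h⟩
    · rintro ⟨⟨b, x⟩, h⟩
      obtain ⟨a, ha⟩ := pick t s _ i b hi hD hA fun j hj l hl => (hst' j hj l hl).symm
      obtain ⟨h1, h2⟩ := upd s t _ i a b x hst hst' fun j hj => (ha j hj).symm
      exact ⟨(a, x), (ih hU _ _ h1 h2).2 h⟩
  | all i φ ih =>
    have hi : i ∈ U := hφ (Finset.mem_insert_self _ _)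
    have hU : φ.vars ⊆ U := (Finset.subset_insert _ _).trans hφ
    have hD := φ.freeVars_subset_vars.trans hU
    constructor
    · rintro h ⟨b, x⟩
      obtain ⟨a, ha⟩ := pick t s _ i b hi hD hA fun j hj l hl => (hst' j hj l hl).symm
      obtain ⟨h1, h2⟩ := upd s t _ i a b x hst hst' fun j hj => (ha j hj).symm
      exact (ih hU _ _ h1 h2).1 (h (a, x))
    · rintro h ⟨a, x⟩
      obtain ⟨b, hb⟩ := pick s t _ i a hi hD hB hst'
      obtain ⟨h1, h2⟩ := upd s t _ i a b x hst hst' hb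
      exact (ih hU _ _ h1 h2).2 (h (b, x))

/-! ### Locally acyclic Cayley graphs of large degree -/

/-- The reduced words of length at most `R` in `d` letters. -/
abbrev ReducedWord (d R : ℕ) : Type :=
  {l : List (Fin d) // l.length ≤ R ∧ l.IsChain (· ≠ ·)}

namespace ReducedWord

variable {d R : ℕ}

instance : Finite (ReducedWord d R) :=
  Set.Finite.subset (List.finite_length_le (Fin d) R) fun _ h => h.1

/-- Multiply a reduced word by a letter, if this does not make it too long. -/
def flip (a : Fin d) (l : ReducedWord d R) : ReducedWord d R :=
  if h : l.1.head? = some a then ⟨l.1.tail, by simpa using l.2.1.trans (by omega), l.2.2.tail⟩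
  else if h' : l.1.length < R then
    ⟨a :: l.1, by simpa using h', List.isChain_cons.2 ⟨fun y hy hay => h (by subst hay; exact hy), l.2.2⟩⟩
  else l

theorem flip_of_isChain (a : Fin d) (l : List (Fin d)) (h : (a :: l).length ≤ R)
    (hc : (a :: l).IsChain (· ≠ ·)) :
    flip a ⟨l, (Nat.le_succ _).trans h, hc.tail⟩ = (⟨a :: l, h, hc⟩ : ReducedWord d R) := by
  have h1 : l.head? ≠ some a := fun h => (List.isChain_cons.1 hc).1 a h rfl
  have h2 : l.length < R := by simpa using h
  simp [flip, h1, h2]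

/-- After a leading `a` is deleted, reducedness ensures that the rest does not start with `a`, so
the second flip restores the letter. Words of full length not starting with `a` are fixed points. -/
theorem flip_involutive (a : Fin d) : Function.Involutive (flip (R := R) a) := by
  rintro ⟨l, hl, hc⟩
  by_cases h : l.head? = some a
  · obtain ⟨l, rfl⟩ : ∃ t, l = a :: t := by
      cases l with
      | nil => simp at h
      | cons b t => exact ⟨t, by simpa using h⟩
    rw [show flip a (⟨a :: l, hl, hc⟩ : ReducedWord d R) = ⟨l, (Nat.le_succ _).trans hl, hc.tail⟩ by simp [flip]]
    exact flip_of_isChain a l hl hc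
  · by_cases h' : l.length < R
    · simp [flip, h, h']
    · simp [flip, h, h']

/-- `flip a` as a permutation. -/
def flipPerm (R : ℕ) (a : Fin d) : Equiv.Perm (ReducedWord d R) := (flip_involutive a).toPerm

theorem flipPerm_mul_self (a : Fin d) : flipPerm R a * flipPerm R a = 1 :=
  Equiv.ext (flip_involutive a)

theorem flipPerm_mul_cancel (a : Fin d) (g : Equiv.Perm (ReducedWord d R)) :
    flipPerm R a * (flipPerm R a * g) = g := by
  rw [← mul_assoc, flipPerm_mul_self, one_mul]

/-- The letters act from right to left, and every suffix is reduced and short enough, so each flip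
prepends its letter. -/
theorem prod_flipPerm_nil (l : List (Fin d)) (hl : l.length ≤ R) (hc : l.IsChain (· ≠ ·)) :
    (l.map (flipPerm R)).prod ⟨[], Nat.zero_le _, .nil⟩ = ⟨l, hl, hc⟩ := by
  induction l with
  | nil => rfl
  | cons a l ih =>
    rw [List.map_cons, List.prod_cons, Equiv.Perm.mul_apply, ih ((Nat.le_succ _).trans hl) hc.tail]
    exact flip_of_isChain a l hl hc

/-- Reduced words of length at most `R` behave as in a free product of groups of order two: the
permutation remembers the word as its value at the empty word. -/
theorem eq_of_prod_flipPerm_mul_eq {l l' : List (Fin d)} (hl : l.length ≤ R)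
    (hc : l.IsChain (· ≠ ·)) (hl' : l'.length ≤ R) (hc' : l'.IsChain (· ≠ ·))
    {g : Equiv.Perm (ReducedWord d R)}
    (h : (l.map (flipPerm R)).prod * g = (l'.map (flipPerm R)).prod * g) : l = l' := by
  have h1 := congrArg (fun p => p ⟨[], Nat.zero_le _, .nil⟩) (mul_right_cancel h)
  simp only [prod_flipPerm_nil l hl hc, prod_flipPerm_nil l' hl' hc'] at h1
  exact congrArg Subtype.val h1

/-- The Cayley graph of the permutation group with respect to the letters. -/
def cayley (d R : ℕ) : SimpleGraph (Equiv.Perm (ReducedWord d R)) where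
  Adj g h := g ≠ h ∧ ∃ a, h = flipPerm R a * g
  symm := ⟨by
    rintro g _ ⟨hne, a, rfl⟩
    exact ⟨hne.symm, a, (flipPerm_mul_cancel a g).symm⟩⟩
  loopless := ⟨fun _ h => h.1 rfl⟩

/-- The one-letter words act differently from each other and from the empty word; `R` must allow
words of length one. -/
theorem le_ncard_neighborSet_cayley (hR : 1 ≤ R) (g : Equiv.Perm (ReducedWord d R)) :
    d ≤ ((cayley d R).neighborSet g).ncard := by
  have hinj : Function.Injective fun a => flipPerm R a * g := by
    intro a b hab
    have := eq_of_prod_flipPerm_mul_eq (l := [a]) (l' := [b]) (g := g) (by simpa) (by simp)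
      (by simpa) (by simp) (by simpa using hab)
    simpa using this
  have hsub : Set.range (fun a => flipPerm R a * g) ⊆ (cayley d R).neighborSet g := by
    rintro _ ⟨a, rfl⟩
    refine ⟨fun h => ?_, a, rfl⟩
    have := eq_of_prod_flipPerm_mul_eq (l := []) (l' := [a]) (g := g) (by simp) (by simp)
      (by simpa) (by simp) (by simpa using h)
    simp at this
  calc d = (Set.range (fun a => flipPerm R a * g)).ncard := by
        rw [← Set.image_univ, Set.ncard_image_of_injective _ hinj, Set.ncard_univ, Nat.card_fin]
    _ ≤ _ := Set.ncard_le_ncard hsub (Set.toFinite _)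

/-- Small sets of vertices of the Cayley graph induce forests. -/
theorem exists_ncard_neighborSet_inter_le_one (S : Set (Equiv.Perm (ReducedWord d R)))
    (hS : S.ncard ≤ R) {s x : Equiv.Perm (ReducedWord d R)} (hs : s ∈ S) (hx : x ∈ S)
    (hsx : (cayley d R).Adj s x) :
    ∃ e ∈ S, e ≠ s ∧ ((cayley d R).neighborSet e ∩ S).ncard ≤ 1 := by
  by_contra! hcon
  -- A non-backtracking walk from `s` inside `S` is encoded by a reduced word, latest letter first;
  -- its suffixes applied to `s` are the vertices visited. The endpoint differs from `s`, hence has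
  -- a second neighbour in `S`, and the walk can be prolonged.
  have step : ∀ n, n + 1 ≤ R → ∃ w : List (Fin d), w.length = n + 1 ∧ w.IsChain (· ≠ ·) ∧
      ∀ k, ((w.drop k).map (flipPerm R)).prod * s ∈ S := by
    intro n
    induction n with
    | zero =>
      intro hR
      obtain ⟨-, a, rfl⟩ := hsx
      refine ⟨[a], rfl, by simp, fun k => ?_⟩
      cases k with
      | zero => simpa using hx
      | succ k => simpa using hs
    | succ n ih =>
      intro hn
      obtain ⟨w, hw, hc, hwS⟩ := ih (by omega)
      obtain ⟨a, u, rfl⟩ : ∃ a u, w = a :: u := List.exists_cons_of_length_eq_add_one hw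
      have he := hcon _ (by simpa using hwS 0) fun h => by
        have := eq_of_prod_flipPerm_mul_eq (l := a :: u) (l' := []) (g := s) (by omega) hc
          (by simp) (by simp) (by simpa using h)
        simp at this
      obtain ⟨y, ⟨⟨-, b, rfl⟩, hyS⟩, hy⟩ :=
        Set.exists_ne_of_one_lt_ncard he ((u.map (flipPerm R)).prod * s)
      refine ⟨b :: a :: u, by simpa using hw, List.isChain_cons.2 ⟨?_, hc⟩, ?_⟩
      · rintro _ ⟨⟩ rfl
        refine hy ?_
        rw [mul_assoc, flipPerm_mul_cancel]
      · intro k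
        cases k with
        | zero => simpa [mul_assoc] using hyS
        | succ k => simpa using hwS k
  obtain ⟨n, hn⟩ : ∃ n, S.ncard = n + 1 :=
    Nat.exists_eq_succ_of_ne_zero (Set.ncard_ne_zero_of_mem hs (Set.toFinite _))
  obtain ⟨w, hw, hc, hwS⟩ := step n (by omega)
  -- The suffixes have lengths 0 to `n + 1`, all at most `R`, so the walk visits `n + 2` distinct
  -- vertices, one more than `S` has.
  have hinj : Set.InjOn (fun k => ((w.drop k).map (flipPerm R)).prod * s)
      (Finset.range (n + 2) : Set ℕ) := by
    intro k hk l hl hkl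
    have hlen := congrArg List.length (eq_of_prod_flipPerm_mul_eq (by simp; omega) (hc.drop k)
      (by simp; omega) (hc.drop l) hkl)
    simp only [List.length_drop, Finset.coe_range, Set.mem_Iio] at hlen hk hl
    omega
  have hle := Set.ncard_le_ncard (s := (fun k => ((w.drop k).map (flipPerm R)).prod * s) ''
    (Finset.range (n + 2) : Set ℕ)) (t := S) (by rintro _ ⟨k, -, rfl⟩; exact hwS k)
    (Set.toFinite _)
  rw [hinj.ncard_image, Set.ncard_coe_finset, Finset.card_range] at hle
  omega

end ReducedWord

/-- There are finite connected graphs of large minimum degree in which all small sets of vertices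
induce forests. -/
theorem exists_connected_minDegree_locally_acyclic (d R : ℕ) (hR : 1 ≤ R) :
    ∃ (X : Type) (_ : Finite X) (G : SimpleGraph X), G.Connected ∧
      (∀ x, d ≤ (G.neighborSet x).ncard) ∧
      ∀ (S : Set X), S.ncard ≤ R → ∀ s ∈ S, ∀ x ∈ S, G.Adj s x →
        ∃ e ∈ S, e ≠ s ∧ (G.neighborSet e ∩ S).ncard ≤ 1 := by
  let G := ReducedWord.cayley d R
  -- Passing to a component gives connectedness; neighbourhoods are unchanged.
  let C := G.connectedComponentMk 1
  refine ⟨C.supp, inferInstance, G.induce C.supp, C.connected_toSimpleGraph, fun x => ?_, ?_⟩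
  · refine (ReducedWord.le_ncard_neighborSet_cayley hR x.1).trans_eq ?_
    rw [← Set.ncard_image_of_injective _ Subtype.val_injective]
    congr 1
    ext y
    constructor
    · intro hy
      exact ⟨⟨y, C.mem_supp_of_adj_mem_supp x.2 hy⟩, hy, rfl⟩
    · rintro ⟨z, hz, rfl⟩
      exact hz
  · intro S hS s hs x hx hsx
    obtain ⟨_, ⟨e, he, rfl⟩, hne, hcard⟩ := ReducedWord.exists_ncard_neighborSet_inter_le_one
      (Subtype.val '' S) (by rwa [Set.ncard_image_of_injective _ Subtype.val_injective])
      (Set.mem_image_of_mem _ hs) (Set.mem_image_of_mem _ hx) hsx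
    refine ⟨e, he, fun h => hne (congrArg _ h), le_trans ?_ hcard⟩
    rw [← Set.ncard_image_of_injective _ Subtype.val_injective]
    refine Set.ncard_le_ncard ?_ (Set.toFinite _)
    rintro _ ⟨y, hy, rfl⟩
    exact ⟨hy.1, y, hy.2, rfl⟩

/-! ### Connectedness and degrees of rooted products -/

section RootedProduct

variable {A X : Type*} {G : SimpleGraph X} {r : X}

theorem rootedProduct_connected [Nonempty A] (hG : G.Connected) (r : X) :
    (rootedProduct A G r).Connected := by
  have hcopy : ∀ (a : A) (x y : X), (rootedProduct A G r).Reachable (a, x) (a, y) := fun a x y =>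
    (hG x y).map (G' := rootedProduct A G r) ⟨fun x => (a, x), fun h => Or.inl ⟨rfl, h⟩⟩
  have : Nonempty X := ⟨r⟩
  refine ⟨?_⟩
  rintro ⟨a, x⟩ ⟨b, y⟩
  by_cases hab : a = b
  · subst hab
    exact hcopy a x y
  · have h : (rootedProduct A G r).Adj (a, r) (b, r) := Or.inr ⟨hab, rfl, rfl⟩
    exact ((hcopy a x r).trans h.reachable).trans (hcopy b r y)

theorem ncard_neighborSet_le_rootedProduct [Finite A] [Finite X] (p : A × X) :
    (G.neighborSet p.2).ncard ≤ ((rootedProduct A G r).neighborSet p).ncard := by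
  rw [← Set.ncard_image_of_injective _ (Prod.mk_right_injective p.1)]
  refine Set.ncard_le_ncard ?_ (Set.toFinite _)
  rintro _ ⟨x, hx, rfl⟩
  exact Or.inl ⟨rfl, hx⟩

end RootedProduct

/-! ### The core and its copies in rooted products -/

section Core

variable {V : Type*} [Finite V] (F : SimpleGraph V)

theorem isCoreSet_coreSet : IsCoreSet F (coreSet F) := (existsUnique_isCoreSet F).choose_spec.1

theorem one_lt_ncard_of_mem_coreSet {v : V} (hv : v ∈ coreSet F) :
    1 < (F.neighborSet v ∩ coreSet F).ncard := by
  by_contra h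
  exact (isCoreSet_coreSet F).2 _ ⟨v, hv, not_lt.1 h, rfl⟩

theorem two_lt_ncard_coreSet (h : (coreSet F).Nonempty) : 2 < (coreSet F).ncard := by
  obtain ⟨v, hv⟩ := h
  have h1 := one_lt_ncard_of_mem_coreSet F hv
  have h2 : F.neighborSet v ∩ coreSet F ⊆ coreSet F \ {v} := fun u hu =>
    ⟨hu.2, fun h => F.ne_of_adj hu.1 h.symm⟩
  have h3 := Set.ncard_le_ncard h2 (Set.toFinite _)
  rw [Set.ncard_sdiff_singleton_of_mem hv] at h3
  omega

end Core

/-- If the pruning process leads from `univ` to `C`, then a copy of the subgraph induced by `C`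
extends to a copy of the whole graph when all degrees are large. -/
theorem isContained_of_pruneStep {V W : Type*} [Finite V] [Finite W] {F : SimpleGraph V}
    {G : SimpleGraph W} {C : Set V} (hC : Relation.ReflTransGen (PruneStep F) Set.univ C)
    (hG : ∀ x, Nat.card V ≤ (G.neighborSet x).ncard) (f : V → W) (hf : Set.InjOn f C)
    (hadj : ∀ u ∈ C, ∀ v ∈ C, F.Adj u v → G.Adj (f u) (f v)) : F ⊑ G := by
  classical
  suffices h : ∃ f : V → W, Set.InjOn f Set.univ ∧
      ∀ u ∈ Set.univ, ∀ v ∈ Set.univ, F.Adj u v → G.Adj (f u) (f v) by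
    obtain ⟨f, hf, hadj⟩ := h
    exact ⟨⟨⟨f, fun {a b} hab => hadj a trivial b trivial hab⟩, Set.injOn_univ.1 hf⟩⟩
  generalize Set.univ = S at hC ⊢
  induction hC using Relation.ReflTransGen.head_induction_on with
  | refl => exact ⟨f, hf, hadj⟩
  | head hstep _ ih =>
    clear hf hadj f
    obtain ⟨v, hvS, hdeg, rfl⟩ := hstep
    rename_i S _
    obtain ⟨f, hf, hadj⟩ := ih
    -- If no neighbour of `v` survives, any value will do for `u₀`, and `v` itself is taken.
    obtain ⟨u₀, hu₀⟩ : ∃ u₀, ∀ u ∈ S, F.Adj v u → u = u₀ := by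
      rcases Set.eq_empty_or_nonempty (F.neighborSet v ∩ S) with h | ⟨u, hu⟩
      · exact ⟨v, fun u hu hvu => absurd (show u ∈ F.neighborSet v ∩ S from ⟨hvu, hu⟩) (by simp [h])⟩
      · exact ⟨u, fun x hx hvx => (Set.ncard_le_one (Set.toFinite _)).1 hdeg x ⟨hvx, hx⟩ u hu⟩
    -- Fewer than `Nat.card V` vertices are occupied, since `v` is not yet placed, so `f u₀` has a
    -- free neighbour.
    obtain ⟨w, hw, hwS⟩ : ∃ w ∈ G.neighborSet (f u₀), w ∉ f '' (S \ {v}) := by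
      refine Set.exists_mem_notMem_of_ncard_lt_ncard (lt_of_lt_of_le ?_ (hG _)) (Set.toFinite _)
      refine (Set.ncard_image_le (Set.toFinite _)).trans_lt ?_
      rw [← Set.ncard_univ]
      exact Set.ncard_lt_ncard ((Set.ssubset_univ_iff).2 fun h =>
        (h ▸ Set.mem_univ v : v ∈ S \ {v}).2 rfl) (Set.toFinite _)
    have hfw : ∀ u ∈ S, u ≠ v → f u ≠ w := fun u hu huv h => hwS ⟨u, ⟨hu, huv⟩, h⟩
    have hwadj : ∀ u ∈ S, F.Adj v u → G.Adj w (f u) := fun u hu huv => by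
      rw [hu₀ u hu huv]; exact G.adj_symm hw
    refine ⟨Function.update f v w, ?_, ?_⟩
    · intro a ha b hb hab
      by_cases hav : a = v <;> by_cases hbv : b = v
      · rw [hav, hbv]
      · subst hav
        simp only [Function.update_self, Function.update_of_ne hbv] at hab
        exact absurd hab.symm (hfw b hb hbv)
      · subst hbv
        simp only [Function.update_self, Function.update_of_ne hav] at hab
        exact absurd hab (hfw a ha hav)
      · simp only [Function.update_of_ne hav, Function.update_of_ne hbv] at hab
        exact hf ⟨ha, hav⟩ ⟨hb, hbv⟩ hab
    · intro a ha b hb hab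
      by_cases hav : a = v
      · subst hav
        rw [Function.update_self, Function.update_of_ne (F.ne_of_adj hab).symm]
        exact hwadj b hb hab
      · by_cases hbv : b = v
        · subst hbv
          rw [Function.update_self, Function.update_of_ne hav]
          exact (hwadj a ha hab.symm).symm
        · rw [Function.update_of_ne hav, Function.update_of_ne hbv]
          exact hadj a ⟨ha, hav⟩ b ⟨hb, hbv⟩ hab

/-- A finite graph of minimum degree at least two is not contained in the rooted product of a smaller
complete graph with a graph in which small sets induce forests. -/
theorem not_isContained_rootedProduct {V B X : Type*} [Finite V] [Finite B] [Finite X]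
    {F : SimpleGraph V} {C : Set V} (hC : ∀ v ∈ C, 1 < (F.neighborSet v ∩ C).ncard)
    (hB : Nat.card B < C.ncard) {G : SimpleGraph X} (r : X)
    (hG : ∀ (S : Set X), S.ncard ≤ C.ncard → ∀ s ∈ S, ∀ x ∈ S, G.Adj s x →
        ∃ e ∈ S, e ≠ s ∧ (G.neighborSet e ∩ S).ncard ≤ 1) :
    ¬ F ⊑ rootedProduct B G r := by
  rintro ⟨f⟩
  have hf := f.injective
  -- By pigeonhole, `C` does not fit on the roots alone.
  obtain ⟨v, hv, hvr⟩ : ∃ v ∈ C, (f v).2 ≠ r := by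
    by_contra! h
    have h1 : Set.InjOn (fun v => (f v).1) C := fun a ha b hb hab =>
      hf (Prod.ext hab ((h a ha).trans (h b hb).symm))
    have h2 := Set.ncard_le_ncard (Set.subset_univ ((fun v => (f v).1) '' C)) (Set.toFinite _)
    rw [h1.ncard_image, Set.ncard_univ] at h2
    omega
  let S : Set X := {x | ∃ v' ∈ C, f v' = ((f v).1, x)}
  have hScard : S.ncard ≤ C.ncard := by
    refine (Set.ncard_le_ncard (t := (fun v => (f v).2) '' C) ?_ (Set.toFinite _)).trans
      (Set.ncard_image_le (Set.toFinite _))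
    rintro x ⟨u, hu, hux⟩
    exact ⟨u, hu, by simp [hux]⟩
  -- Edges leave a copy of `X` only at its root, so elsewhere all neighbours in the image of `C`
  -- stay in the copy.
  have hmin : ∀ e ∈ S, e ≠ r → 1 < (G.neighborSet e ∩ S).ncard := by
    rintro e ⟨u, hu, hue⟩ her
    refine (hC u hu).trans_le ?_
    rw [← Set.ncard_image_of_injective _ hf,
      ← Set.ncard_image_of_injective (G.neighborSet e ∩ S) (Prod.mk_right_injective (f v).1)]
    refine Set.ncard_le_ncard ?_ (Set.toFinite _)
    rintro _ ⟨w, ⟨huw, hw⟩, rfl⟩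
    have h := f.toHom.map_adj huw
    change (rootedProduct B G r).Adj (f u) (f w) at h
    rw [hue] at h
    rcases h with ⟨h1, h2⟩ | ⟨-, h2, -⟩
    · exact ⟨(f w).2, ⟨h2, w, hw, Prod.ext h1.symm rfl⟩, Prod.ext h1 rfl⟩
    · exact absurd h2 her
  have hvS : (f v).2 ∈ S := ⟨v, hv, rfl⟩
  by_cases hr : r ∈ S ∧ ∃ x ∈ S, G.Adj r x
  · obtain ⟨hrS, x, hx, hrx⟩ := hr
    obtain ⟨e, he, her, hcard⟩ := hG S hScard r hrS x hx hrx
    exact absurd (hmin e he her) (not_lt.2 hcard)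
  -- Here the root is absent from `S` or isolated in it, so discarding it changes no other degree,
  -- and acyclicity applies to the rest.
  · have hmin' : ∀ e ∈ S, e ≠ r → ∀ x ∈ G.neighborSet e ∩ S, x ≠ r := by
      rintro e he her x hx rfl
      exact hr ⟨hx.2, e, he, hx.1.symm⟩
    have hinter : ∀ e ∈ S, e ≠ r → G.neighborSet e ∩ S = G.neighborSet e ∩ (S \ {r}) :=
      fun e he her => Set.Subset.antisymm (fun x hx => ⟨hx.1, hx.2, hmin' e he her x hx⟩)
        (Set.inter_subset_inter_right _ Set.sdiff_subset)
    obtain ⟨x, hx⟩ := Set.nonempty_of_ncard_ne_zero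
      (Nat.ne_of_gt (zero_lt_one.trans (hmin _ hvS hvr)))
    rw [hinter _ hvS hvr] at hx
    obtain ⟨e, he, -, hcard⟩ := hG (S \ {r}) ((Set.ncard_le_ncard Set.sdiff_subset
      (Set.toFinite _)).trans hScard) _ ⟨hvS, hvr⟩ x hx.2 hx.1
    rw [← hinter e he.1 he.2] at hcard
    exact absurd (hmin e he.1 he.2) (not_lt.2 hcard)

/-! ### The core bound -/

/-- The defining property of `DefinesSubgraphTw`, for graphs on arbitrary finite vertex sets. -/
theorem DefinesSubgraphTw.exists_forall {V : Type*} {F : SimpleGraph V} {φ : GraphFormula}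
    (h : DefinesSubgraphTw F φ) : ∃ k : ℕ, ∀ (W : Type) [Finite W] (G : SimpleGraph W),
      G.Connected → k ≤ treewidth G → (GraphFormula.Models G φ ↔ F ⊑ G) := by
  obtain ⟨k, hk⟩ := h
  refine ⟨k, fun W _ G hG hGk => ?_⟩
  obtain ⟨n, ⟨e⟩⟩ := Finite.exists_equiv_fin W
  have e' : G ≃g G.map e.toEmbedding := SimpleGraph.Iso.map e G
  rw [GraphFormula.models_iso e' φ, hk n _ (e'.connected_iff.1 hG) (e'.treewidth_eq ▸ hGk)]
  exact ⟨fun h => h.trans ⟨e'.symm.toCopy⟩, fun h => h.trans ⟨e'.toCopy⟩⟩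

theorem exists_width_eq_Wtw {V : Type*} [Finite V] (F : SimpleGraph V) :
    ∃ φ : GraphFormula, φ.IsSentence ∧ DefinesSubgraphTw F φ ∧ φ.width = Wtw F := by
  obtain ⟨φ, h1, h2, -⟩ := exists_definesSubgraphTw F
  exact Nat.sInf_mem (s := {w : ℕ | ∃ φ : GraphFormula, φ.IsSentence ∧ DefinesSubgraphTw F φ ∧
    φ.width = w}) ⟨_, φ, h1, h2, rfl⟩

theorem ncard_coreSet_le_Wtw {V : Type*} [Finite V] (F : SimpleGraph V) :
    (coreSet F).ncard ≤ Wtw F := by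
  obtain ⟨φ, hφ, hdef, hw⟩ := exists_width_eq_Wtw F
  rw [← hw]
  by_contra! hlt
  obtain ⟨k, hk⟩ := hdef.exists_forall
  set l := (coreSet F).ncard with hl
  have hl2 : 2 < l := two_lt_ncard_coreSet F (Set.nonempty_of_ncard_ne_zero (by omega))
  -- Degree at least `k` forces the treewidth, degree at least `Nat.card V` lets the pruned vertices
  -- be placed greedily, and `l` bounds the trace of the core in one copy.
  obtain ⟨X, _, G, hG, hdeg, hloc⟩ := exists_connected_minDegree_locally_acyclic
    (max k (Nat.card V)) l (by omega)
  obtain ⟨r⟩ := hG.nonempty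
  have hmod : ∀ m, 0 < m → (GraphFormula.Models (rootedProduct (Fin m) G r) φ ↔
      F ⊑ rootedProduct (Fin m) G r) := by
    intro m hm
    have : Nonempty (Fin m) := ⟨⟨0, hm⟩⟩
    refine hk _ _ (rootedProduct_connected hG r) ?_
    have : Nonempty (Fin m × X) := ⟨⟨⟨0, hm⟩, r⟩⟩
    obtain ⟨p, hp⟩ := exists_ncard_neighborSet_le_treewidth (rootedProduct (Fin m) G r)
    exact (le_max_left _ _).trans
      ((hdeg p.2).trans ((ncard_neighborSet_le_rootedProduct p).trans hp))
  have hequiv : GraphFormula.Models (rootedProduct (Fin l) G r) φ ↔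
      GraphFormula.Models (rootedProduct (Fin (l - 1)) G r) φ := by
    have h := fun s t => sat_rootedProduct_iff (A := Fin l) (B := Fin (l - 1)) G r φ.vars
      (by rw [Nat.card_fin]; exact hlt.le) (by rw [Nat.card_fin]; exact Nat.le_sub_one_of_lt hlt)
      φ subset_rfl s t (by rw [hφ]; simp) (by rw [hφ]; simp)
    exact ⟨fun h' t => (h (fun _ => (⟨0, by omega⟩, r)) t).1 (h' _),
      fun h' s => (h s (fun _ => (⟨0, by omega⟩, r))).2 (h' _)⟩
  rw [hmod l (by omega), hmod (l - 1) (by omega)] at hequiv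
  refine not_isContained_rootedProduct (fun v => one_lt_ncard_of_mem_coreSet F)
    (by rw [Nat.card_fin]; omega) r hloc (hequiv.1 ?_)
  -- The core is mapped bijectively onto the `l` roots, which form a clique.
  have e : coreSet F ≃ Fin l := Finite.equivFinOfCardEq (Nat.card_coe_set_eq _)
  classical
  refine isContained_of_pruneStep (isCoreSet_coreSet F).1 (fun x => (le_max_right _ _).trans
    ((hdeg x.2).trans (ncard_neighborSet_le_rootedProduct x)))
    (fun v => if h : v ∈ coreSet F then (e ⟨v, h⟩, r) else (⟨0, by omega⟩, r)) ?_ ?_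
  · intro a ha b hb hab
    simpa [ha, hb] using hab
  · intro a ha b hb hab
    refine Or.inr ⟨?_, by simp [ha], by simp [hb]⟩
    simpa [ha, hb] using F.ne_of_adj hab

/-! ### Adjacency and depth in megastars -/

section Megastar

/-- The distance from the centre of a megastar. -/
def megastarDepth {s b : ℕ} : Option (Fin s × Fin b) → ℕ
  | none => 0
  | some (_, j) => j + 1

theorem megastar_adj_none_some {s b : ℕ} {i : Fin s} {j : Fin b} :
    (megastar s b).Adj none (some (i, j)) ↔ (j : ℕ) = 0 := by
  simp [megastar]

theorem megastar_adj_some_some {s b : ℕ} {i i' : Fin s} {j j' : Fin b} :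
    (megastar s b).Adj (some (i, j)) (some (i', j')) ↔
      i = i' ∧ ((j' : ℕ) = j + 1 ∨ (j : ℕ) = j' + 1) := by
  simp only [megastar, SimpleGraph.fromRel_adj, ne_eq, Option.some.injEq, Prod.mk.injEq]
  constructor
  · rintro ⟨-, ⟨rfl, h⟩ | ⟨rfl, h⟩⟩
    exacts [⟨rfl, .inl h⟩, ⟨rfl, .inr h⟩]
  · rintro ⟨rfl, h⟩
    refine ⟨?_, h.imp (⟨rfl, ·⟩) (⟨rfl, ·⟩)⟩
    rintro ⟨-, rfl⟩
    omega

theorem megastarDepth_le_of_adj {s b : ℕ} {x y : Option (Fin s × Fin b)}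
    (h : (megastar s b).Adj x y) : megastarDepth y ≤ megastarDepth x + 1 := by
  rcases x with _ | ⟨i, j⟩ <;> rcases y with _ | ⟨i', j'⟩
  · exact absurd h (SimpleGraph.irrefl _)
  · rw [megastar_adj_none_some] at h
    simp [megastarDepth, h]
  · simp [megastarDepth]
  · rw [megastar_adj_some_some] at h
    simp only [megastarDepth]
    omega

end Megastar

/-! ### Networks of megastars and their small subgraphs -/

section StarNetwork

variable {N : Type*} {b : ℕ}

/-- Disjoint megastars with three arms, one for each node in `N`, where the end of the arm `p` is
joined to the end of the arm `σ p` (unless `p` is a fixed point of `σ`). -/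
def starNetwork (b : ℕ) (σ : N × Fin 3 → N × Fin 3) (hσ : Function.Involutive σ) :
    SimpleGraph (N × Option (Fin 3 × Fin (b + 1))) where
  Adj x y := (x.1 = y.1 ∧ (megastar 3 (b + 1)).Adj x.2 y.2) ∨
    ∃ p, σ p ≠ p ∧ x = (p.1, some (p.2, Fin.last b)) ∧ y = ((σ p).1, some ((σ p).2, Fin.last b))
  symm := ⟨by
    rintro x y (⟨h1, h2⟩ | ⟨p, hp, rfl, rfl⟩)
    · exact .inl ⟨h1.symm, h2.symm⟩
    · exact .inr ⟨σ p, by rw [hσ p]; exact hp.symm, rfl, by rw [hσ p]⟩⟩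
  loopless := ⟨by
    rintro x (⟨-, h⟩ | ⟨p, hp, rfl, h⟩)
    · exact SimpleGraph.irrefl _ h
    · refine hp (Prod.ext ?_ ?_)
      · simpa using (congrArg Prod.fst h).symm
      · simpa using (congrArg Prod.snd h).symm⟩

variable {σ : N × Fin 3 → N × Fin 3} {hσ : Function.Involutive σ}

/-- A small connected subgraph of a star network that contains a centre lies in one megastar. -/
theorem isContained_megastar_of_center {V : Type*} [Finite V] {F : SimpleGraph V}
    (hF : F.Connected) (hb : Nat.card V ≤ b) (f : F.Copy (starNetwork b σ hσ)) {v₀ : V}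
    (hv₀ : (f v₀).2 = none) : F ⊑ megastar 3 (b + 1) := by
  have := Fintype.ofFinite V
  -- Each step raises the depth by at most one, and links between arms start at depth `b + 1`, out
  -- of reach of walks of length at most `b`.
  have hwalk : ∀ (m : ℕ) (v : V) (w : F.Walk v₀ v), w.length = m → m ≤ b →
      (f v).1 = (f v₀).1 ∧ megastarDepth (f v).2 ≤ m := by
    intro m
    induction m with
    | zero =>
      intro v w hw _
      obtain rfl := SimpleGraph.Walk.eq_of_length_eq_zero hw
      simp [hv₀, megastarDepth]
    | succ m ih =>
      intro v w hw hm
      obtain ⟨u, huv, w', hw'⟩ : ∃ (u : V) (_ : F.Adj u v) (w' : F.Walk v₀ u), w'.length = m :=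
        ⟨_, w.adj_penultimate (by rw [← SimpleGraph.Walk.length_eq_zero_iff]; omega), w.dropLast, by simp [hw]⟩
      obtain ⟨h1, h2⟩ := ih u w' hw' (by omega)
      have hadj : (starNetwork b σ hσ).Adj (f u) (f v) := f.toHom.map_adj huv
      rcases hadj with ⟨h3, h4⟩ | ⟨p, -, hp, -⟩
      · exact ⟨h3.symm.trans h1, (megastarDepth_le_of_adj h4).trans (by omega)⟩
      · rw [hp] at h2
        simp only [megastarDepth, Fin.val_last] at h2
        omega
  have hall : ∀ v, (f v).1 = (f v₀).1 ∧ megastarDepth (f v).2 < b + 1 := by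
    intro v
    obtain ⟨w, hw⟩ := (hF v₀ v).exists_isPath
    have hlen := hw.length_lt
    rw [← Nat.card_eq_fintype_card] at hlen
    have := hwalk _ v w rfl (by omega)
    exact ⟨this.1, by omega⟩
  refine ⟨⟨⟨fun v => (f v).2, fun {u v} huv => ?_⟩, fun u v huv =>
    f.injective (Prod.ext ((hall u).1.trans (hall v).1.symm) huv)⟩⟩
  have hadj : (starNetwork b σ hσ).Adj (f u) (f v) := f.toHom.map_adj huv
  rcases hadj with ⟨-, h⟩ | ⟨p, -, hp, -⟩
  · exact h
  · have := (hall u).2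
    rw [hp] at this
    simp [megastarDepth] at this

/-- A connected subgraph of a star network that contains no centre is contained in a path. -/
theorem isContained_megastar_of_forall_ne_center {V : Type*} {F : SimpleGraph V}
    (hF : F.Connected) (f : F.Copy (starNetwork b σ hσ)) (hf : ∀ v, (f v).2 ≠ none) :
    F ⊑ megastar 3 (2 * (b + 1)) := by
  classical
  have hport : ∀ v, ∃ (p : N × Fin 3) (t : Fin (b + 1)), f v = (p.1, some (p.2, t)) := by
    intro v
    obtain ⟨⟨a, t⟩, h⟩ := Option.ne_none_iff_exists'.1 (hf v)
    exact ⟨((f v).1, a), t, Prod.ext rfl h⟩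
  choose p t hpt using hport
  have hadj : ∀ u v, F.Adj u v → (p u = p v ∧ ((t v : ℕ) = t u + 1 ∨ (t u : ℕ) = t v + 1)) ∨
      (σ (p u) ≠ p u ∧ p v = σ (p u) ∧ (t u : ℕ) = b ∧ (t v : ℕ) = b) := by
    intro u v huv
    have h : (starNetwork b σ hσ).Adj (f u) (f v) := f.toHom.map_adj huv
    rw [hpt u, hpt v] at h
    rcases h with ⟨h1, h2⟩ | ⟨q, hq, h1, h2⟩
    · rw [megastar_adj_some_some] at h2
      exact .inl ⟨Prod.ext h1 h2.1, h2.2⟩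
    · simp only [Prod.mk.injEq, Option.some.injEq] at h1 h2
      obtain rfl : p u = q := Prod.ext h1.1 h1.2.1
      exact .inr ⟨hq, Prod.ext h2.1 h2.2.1, by simp [h1.2.2], by simp [h2.2.2]⟩
  obtain ⟨v₀⟩ := hF.nonempty
  have hall : ∀ v, p v = p v₀ ∨ p v = σ (p v₀) := by
    intro v
    induction (SimpleGraph.reachable_iff_reflTransGen v₀ v).1 (hF v₀ v) with
    | refl => exact .inl rfl
    | tail _ huv ih =>
      rcases hadj _ _ huv with ⟨h, -⟩ | ⟨-, h, -, -⟩
      · rwa [h] at ih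
      · rcases ih with ih | ih
        · exact .inr (by rw [h, ih])
        · exact .inl (by rw [h, ih, hσ])
  -- The image lies in one arm and the arm linked to it. The first is laid out as positions 0 to
  -- `b`, the second backwards as `b + 1` to `2 * b + 1`, so that the two linked ends become
  -- consecutive.
  let g : V → Fin (2 * (b + 1)) := fun v =>
    if p v = p v₀ then ⟨t v, by omega⟩ else ⟨2 * b + 1 - t v, by omega⟩
  have hg : ∀ v, (p v = p v₀ ∧ (g v : ℕ) = t v) ∨
      (p v ≠ p v₀ ∧ p v = σ (p v₀) ∧ (g v : ℕ) = 2 * b + 1 - t v) := by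
    intro v
    by_cases h : p v = p v₀
    · exact .inl ⟨h, by simp [g, h]⟩
    · exact .inr ⟨h, (hall v).resolve_left h, by simp [g, h]⟩
  refine ⟨⟨⟨fun v => some (0, g v), fun {u v} huv => ?_⟩, fun u v huv => ?_⟩⟩
  · rw [megastar_adj_some_some]
    refine ⟨rfl, ?_⟩
    have htu := (t u).isLt
    have htv := (t v).isLt
    rcases hadj u v huv with ⟨h1, h2⟩ | ⟨h1, h2, h3, h4⟩
    · rcases hg u with ⟨hu, hu'⟩ | ⟨hu, -, hu'⟩ <;> rcases hg v with ⟨hv, hv'⟩ | ⟨hv, -, hv'⟩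
      · omega
      · exact absurd (h1.symm.trans hu) hv
      · exact absurd (h1.trans hv) hu
      · omega
    · rcases hg u with ⟨hu, hu'⟩ | ⟨hu, hu'', hu'⟩ <;> rcases hg v with ⟨hv, hv'⟩ | ⟨hv, hv'', hv'⟩
      · exact absurd (h2.symm.trans (hv.trans hu.symm)) h1
      · omega
      · omega
      · exact absurd (h2.symm.trans (hv''.trans hu''.symm)) h1
  · have huv : (g u : ℕ) = g v := by
      have : g u = g v := by simpa using huv
      rw [this]
    have htu := (t u).isLt
    have htv := (t v).isLt
    have key : p u = p v ∧ (t u : ℕ) = t v := by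
      rcases hg u with ⟨hu, hu'⟩ | ⟨hu, hu'', hu'⟩ <;> rcases hg v with ⟨hv, hv'⟩ | ⟨hv, hv'', hv'⟩
      · exact ⟨hu.trans hv.symm, by omega⟩
      · omega
      · omega
      · exact ⟨hu''.trans hv''.symm, by omega⟩
    exact f.injective (show f u = f v by rw [hpt u, hpt v, key.1, Fin.ext key.2])

/-- A star network has, up to size `b`, no connected subgraphs but those of megastars. -/
theorem not_isContained_starNetwork {V : Type*} [Finite V] {F : SimpleGraph V}
    (hF : F.Connected) (hb : Nat.card V ≤ b) (hM : ¬ ∃ b : ℕ, F ⊑ megastar 3 b) :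
    ¬ F ⊑ starNetwork b σ hσ := by
  rintro ⟨f⟩
  by_cases h : ∃ v, (f v).2 = none
  · obtain ⟨v, hv⟩ := h
    exact hM ⟨_, isContained_megastar_of_center hF hb f hv⟩
  · exact hM ⟨_, isContained_megastar_of_forall_ne_center hF f fun v hv => h ⟨v, hv⟩⟩

/-- The map `π` groups the stars into classes to be contracted; the relation describes walks that
never leave a class. -/
theorem starNetwork_reflTransGen_symm {P : Type*} (π : N → P)
    {x y : N × Option (Fin 3 × Fin (b + 1))}
    (h : Relation.ReflTransGen (fun x y => (starNetwork b σ hσ).Adj x y ∧ π x.1 = π y.1) x y) :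
    Relation.ReflTransGen (fun x y => (starNetwork b σ hσ).Adj x y ∧ π x.1 = π y.1) y x := by
  induction h with
  | refl => exact .refl
  | tail _ h ih => exact .head ⟨h.1.symm, h.2.symm⟩ ih

/-- Every vertex of a star is connected to its centre, within the star. -/
theorem starNetwork_reflTransGen_center {P : Type*} (π : N → P) (ν : N)
    (x : Option (Fin 3 × Fin (b + 1))) :
    Relation.ReflTransGen (fun x y => (starNetwork b σ hσ).Adj x y ∧ π x.1 = π y.1)
      (ν, none) (ν, x) := by
  rcases x with _ | ⟨a, ⟨t, ht⟩⟩
  · exact .refl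
  · induction t with
    | zero => exact .single ⟨.inl ⟨rfl, megastar_adj_none_some.2 rfl⟩, rfl⟩
    | succ t ih =>
      exact (ih (by omega)).tail ⟨.inl ⟨rfl, megastar_adj_some_some.2 ⟨rfl, .inl rfl⟩⟩, rfl⟩

/-- Centres joined by arms are connected, within the two stars. -/
theorem starNetwork_reflTransGen_centers {P : Type*} (π : N → P) (p : N × Fin 3)
    (hπ : π p.1 = π (σ p).1) :
    Relation.ReflTransGen (fun x y => (starNetwork b σ hσ).Adj x y ∧ π x.1 = π y.1)
      (p.1, none) ((σ p).1, none) := by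
  by_cases hp : σ p = p
  · rw [hp]
  · exact ((starNetwork_reflTransGen_center π p.1 (some (p.2, Fin.last b))).tail
      ⟨.inr ⟨p, hp, rfl, rfl⟩, hπ⟩).trans
      (starNetwork_reflTransGen_symm π (starNetwork_reflTransGen_center π (σ p).1 (some ((σ p).2, Fin.last b))))

end StarNetwork

/-! ### A star network of large treewidth -/

section Grid

/-- The arms `0` and `1` link the nodes `(i, j)` of row `i` cyclically, and the arms `2` link
`(i, j)` with `(j, i)`. -/
def gridPort (n : ℕ) (p : (Fin (n + 1) × Fin (n + 1)) × Fin 3) :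
    (Fin (n + 1) × Fin (n + 1)) × Fin 3 :=
  match p with
  | ((i, j), 0) => ((i, j + 1), 1)
  | ((i, j), 1) => ((i, j - 1), 0)
  | ((i, j), 2) => ((j, i), 2)

theorem gridPort_involutive (n : ℕ) : Function.Involutive (gridPort n) := by
  rintro ⟨⟨i, j⟩, a⟩
  fin_cases a <;> simp [gridPort]

/-- A subdivided graph of maximum degree three whose rows can be contracted to a complete graph. -/
def starGrid (n b : ℕ) :
    SimpleGraph ((Fin (n + 1) × Fin (n + 1)) × Option (Fin 3 × Fin (b + 1))) :=
  starNetwork b (gridPort n) (gridPort_involutive n)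

/-- The links between arms `0` and `1` string the stars of a row together, so rows can serve as
branch sets of a complete minor. -/
theorem starGrid_row (n b : ℕ) (i j j' : Fin (n + 1)) (x y : Option (Fin 3 × Fin (b + 1))) :
    Relation.ReflTransGen (fun x y => (starGrid n b).Adj x y ∧ x.1.1 = y.1.1)
      ((i, j), x) ((i, j'), y) := by
  have hrow : ∀ j : Fin (n + 1), Relation.ReflTransGen
      (fun x y => (starGrid n b).Adj x y ∧ x.1.1 = y.1.1) ((i, 0), none) ((i, j), none) := by
    intro j
    induction j using Fin.induction with
    | zero => exact .refl
    | succ j ih =>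
      have h := starNetwork_reflTransGen_centers (b := b) (hσ := gridPort_involutive n) Prod.fst
        ((i, j.castSucc), 0) rfl
      rw [show (gridPort n ((i, j.castSucc), 0)).1 = (i, j.succ) by
        simp [gridPort]] at h
      exact ih.trans h
  have hall : ∀ j x, Relation.ReflTransGen
      (fun x y => (starGrid n b).Adj x y ∧ x.1.1 = y.1.1) ((i, 0), none) ((i, j), x) :=
    fun j x => (hrow j).trans (starNetwork_reflTransGen_center Prod.fst (i, j) x)
  exact (starNetwork_reflTransGen_symm Prod.fst (hall j x)).trans (hall j' y)

/-- These links supply the edge between any two rows. On the diagonal the port is a fixed point and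
the arm ends freely. -/
theorem starGrid_adj {n b : ℕ} {i i' : Fin (n + 1)} (h : i ≠ i') :
    (starGrid n b).Adj ((i, i'), some (2, Fin.last b)) ((i', i), some (2, Fin.last b)) :=
  .inr ⟨((i, i'), 2), by simp [gridPort, h, h.symm], rfl, rfl⟩

theorem starGrid_connected (n b : ℕ) : (starGrid n b).Connected := by
  have hrow : ∀ (i j j' : Fin (n + 1)) (x y : Option (Fin 3 × Fin (b + 1))),
      (starGrid n b).Reachable ((i, j), x) ((i, j'), y) := fun i j j' x y =>
    (SimpleGraph.reachable_iff_reflTransGen _ _).2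
      (Relation.ReflTransGen.mono (fun _ _ h => h.1) _ _ (starGrid_row n b i j j' x y))
  refine ⟨?_⟩
  rintro ⟨⟨i, j⟩, x⟩ ⟨⟨i', j'⟩, y⟩
  by_cases h : i = i'
  · subst h
    exact hrow i j j' x y
  · exact ((hrow i j i' x _).trans (starGrid_adj h).reachable).trans (hrow i' i j' _ y)

theorem le_treewidth_top (n : ℕ) : n ≤ treewidth (⊤ : SimpleGraph (Fin (n + 1))) := by
  obtain ⟨v, hv⟩ := exists_ncard_neighborSet_le_treewidth (⊤ : SimpleGraph (Fin (n + 1)))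
  refine le_trans ?_ hv
  rw [SimpleGraph.neighborSet_top, Set.ncard_compl, Set.ncard_singleton, Nat.card_fin]
  simp

/-- Contracting every row yields the complete graph on `n + 1` vertices. -/
theorem le_treewidth_starGrid (n b : ℕ) : n ≤ treewidth (starGrid n b) := by
  refine (le_treewidth_top n).trans (treewidth_le_of_contraction (fun x => x.1.1)
    (fun i => ⟨((i, 0), none), rfl⟩) ?_ fun i i' h => ⟨_, _, starGrid_adj h, rfl, rfl⟩)
  rintro ⟨⟨i, j⟩, x⟩ ⟨⟨i', j'⟩, y⟩ h
  obtain rfl : i = i' := h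
  exact starGrid_row n b i j j' x y

end Grid

/-! ### The treewidth bound -/

theorem two_le_Wtw {V : Type*} [Finite V] {F : SimpleGraph V} (hF : F.Connected)
    (hM : ¬ ∃ b : ℕ, F ⊑ megastar 3 b) : 2 ≤ Wtw F := by
  obtain ⟨φ, -, hdef, hw⟩ := exists_width_eq_Wtw F
  rw [← hw]
  by_contra! hlt
  obtain ⟨k, hk⟩ := hdef.exists_forall
  obtain ⟨i, hi⟩ : ∃ i, φ.vars ⊆ {i} :=
    Finset.card_le_one_iff_subset_singleton.1 (Nat.le_of_lt_succ hlt)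
  -- Treewidth at least `k` is needed for both graphs, and more than `Nat.card V` vertices leave
  -- room for `F` in the complete graph.
  set n := max k (Nat.card V)
  have hsat := GraphFormula.sat_iff_of_vars_subset_singleton
    (⊤ : SimpleGraph (Fin (n + 1))) (starGrid n (Nat.card V)) i φ hi
  have hiff : GraphFormula.Models (⊤ : SimpleGraph (Fin (n + 1))) φ ↔
      GraphFormula.Models (starGrid n (Nat.card V)) φ :=
    ⟨fun h t => (hsat (fun _ => 0) t).1 (h _), fun h s => (hsat s fun _ => ((0, 0), none)).2 (h _)⟩
  rw [hk _ _ SimpleGraph.connected_top ((le_max_left _ _).trans (le_treewidth_top n)),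
    hk _ _ (starGrid_connected n _) ((le_max_left _ _).trans (le_treewidth_starGrid n _))] at hiff
  refine not_isContained_starNetwork hF le_rfl hM (hiff.1 ?_)
  have := Fintype.ofFinite V
  obtain ⟨e⟩ : Nonempty (V ↪ Fin (n + 1)) := by
    refine Function.Embedding.nonempty_of_card_le ?_
    rw [Fintype.card_fin, ← Nat.card_eq_fintype_card]
    exact (le_max_right _ _).trans (Nat.le_succ _)
  exact ⟨⟨⟨e, fun h => e.injective.ne (F.ne_of_adj h)⟩, e.injective⟩⟩

theorem theorem4p2 {V : Type*} [Finite V] (F : SimpleGraph V) :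
    Nat.card (coreSet F) ≤ Wtw F ∧
    (F.Connected → (¬ ∃ b : ℕ, F ⊑ megastar 3 b) → treewidth F + 1 ≤ Wtw F) := by
  rw [Nat.card_coe_set_eq]
  refine ⟨ncard_coreSet_le_Wtw F, fun hF hM => ?_⟩
  have hprune := (isCoreSet_coreSet F).1
  rcases Set.eq_empty_or_nonempty (coreSet F) with h | h
  · have h1 := treewidth_le_of_pruneStep hprune le_rfl (by simp [h])
    have h2 := two_le_Wtw hF hM
    omega
  · have h1 := two_lt_ncard_coreSet F h
    -- The whole core is one bag; it has at least three vertices, so the bags of size two for pruned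
    -- vertices fit within the same width.
    have h2 := treewidth_le_of_pruneStep hprune (w := (coreSet F).ncard - 1) (by omega) (by omega)
    have h3 := ncard_coreSet_le_Wtw F
    omega
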